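/- Let $\hat{\mathbb R}=\mathbb R\cup\{\infty\}$. For a real rational function $f\in\mathbb R(x)$ let $h_{\mathbb R}(f)$ be its real entropy, i.e. the topological entropy of the induced map $f\restriction_{\hat{\mathbb R}}:\hat{\mathbb R}\to\hat{\mathbb R}$. For $\mu\neq 0$ and $t\in\mathbb R$ put $$f_{\mu,t}(x)=\frac{2\mu x(tx+2)}{\mu^2x^2+(tx+2)^2},$$ and consider the parameter domains $$U_1=\{(\mu,t)\mid \mu,t>0,\ 2-\mu<t<2\},$$ $$U_2=\{(\mu,t)\mid \mu,t<0,\ t-2\le\mu<-|t+2|\},$$ $$U_3=\{(\mu,t)\mid \mu,t<0,\ \mu<\min\{t-2,\,1-\tfrac{t^2}{4}\}\}.$$ Then: 1. For $(\mu,t)\in U_1$, $f_{\mu,t}$ restricts to a continuous unimodal self-map of $[-1,0]$, i.e. one with exactly two laps (family $\mathcal F_1$). 2. For $(\mu,t)\in U_2$, $f_{\mu,t}$ restricts to a continuous unimodal self-map of $[-1,1]$ (family $\mathcal F_2$). 3. For $(\mu,t)\in U_3$, $f_{\mu,t}$ restricts to a continuous $(+-+)$-bimodal self-map of $[-1,1]$,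 i.e. one with exactly three laps, on which it is strictly increasing, strictly decreasing and strictly increasing, in this order (family $\mathcal F_3$). 4. Every real quadratic rational map $f$ (that is, $f\in\mathbb R(x)$ of degree $2$) is conjugate by an element of $\mathrm{PGL}_2(\mathbb R)$ to $f_{\mu,t}$ for some $(\mu,t)\in U_1\cup U_2\cup U_3$, or satisfies $h_{\mathbb R}(f)=0$ or $h_{\mathbb R}(f)=\log 2$. -/

import Mathlib

open Polynomial Set

noncomputable section

namespace RealQuadratic

/-- The degree of a rational function: the maximum of the degrees of its numerator and denominator
in lowest terms. -/
def ratDegree (f : RatFunc ℝ) : ℕ := max f.num.natDegree f.denom.natDegree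

/-- The self-map `f ↾ ℝ̂ : ℝ̂ → ℝ̂` of the circle `ℝ̂ = ℝ ∪ {∞}` induced by a real rational function.
As `f.num` and `f.denom` are coprime, a zero of `f.denom` is a pole of `f`; the value at `∞` is the
ratio of the coefficients of degree `ratDegree f`, which do not both vanish. -/
def circleMap (f : RatFunc ℝ) : OnePoint ℝ → OnePoint ℝ := fun p =>
  p.elim
    (if f.denom.coeff (ratDegree f) = 0 then OnePoint.infty
      else ((f.num.coeff (ratDegree f) / f.denom.coeff (ratDegree f) : ℝ) : OnePoint ℝ))
    (fun x => if f.denom.eval x = 0 then OnePoint.infty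
      else ((f.num.eval x / f.denom.eval x : ℝ) : OnePoint ℝ))

/-- Topological entropy of a self-map of a compact Hausdorff space, computed with the unique
uniform structure that induces the topology. -/
def topEntropy {X : Type*} [TopologicalSpace X] [CompactSpace X] [T2Space X] (T : X → X) : EReal :=
  letI : UniformSpace X := uniformSpaceOfCompactR1
  Dynamics.coverEntropy T Set.univ

/-- The real entropy `h_ℝ(f)`: the topological entropy of `f` on the circle `ℝ ∪ {∞}`. -/
def realEntropy (f : RatFunc ℝ) : EReal := topEntropy (circleMap f)

/-- Conjugacy of real rational functions by an element of `PGL₂(ℝ)`, written on the invariant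
circle `ℝ ∪ {∞}`, where `GL₂(ℝ)` acts by Möbius transformations. A rational function is determined
by its values on this infinite set, so this is the equality `g ∘ f = k ∘ g` of rational
functions. -/
def RealConj (f k : RatFunc ℝ) : Prop :=
  ∃ g : GL (Fin 2) ℝ, ∀ p : OnePoint ℝ, g • circleMap f p = circleMap k (g • p)

/-- The normal form `2μx(tx+2) / (μ²x² + (tx+2)²)` as a real rational function. -/
def normalForm (μ t : ℝ) : RatFunc ℝ :=
  algebraMap ℝ[X] (RatFunc ℝ) (C (2 * μ) * X * (C t * X + C 2)) /
    algebraMap ℝ[X] (RatFunc ℝ) (C (μ ^ 2) * X ^ 2 + (C t * X + C 2) ^ 2)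

/-- The normal form as a function of a real variable (for `μ ≠ 0` the denominator never
vanishes on `ℝ`). -/
def normalFun (μ t x : ℝ) : ℝ :=
  2 * μ * x * (t * x + 2) / (μ ^ 2 * x ^ 2 + (t * x + 2) ^ 2)

/-- For `μ ≠ 0`, the circle map of the rational function `normalForm μ t` restricts on `ℝ` to
`normalFun μ t`. -/
theorem circleMap_normalForm_coe {μ : ℝ} (hμ : μ ≠ 0) (t x : ℝ) :
    circleMap (normalForm μ t) (x : OnePoint ℝ) = ((normalFun μ t x : ℝ) : OnePoint ℝ) := by
  set P : ℝ[X] := C (2 * μ) * X * (C t * X + C 2) with hP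
  set Q : ℝ[X] := C (μ ^ 2) * X ^ 2 + (C t * X + C 2) ^ 2 with hQ
  have hx : 0 < Q.eval x := by
    have h : Q.eval x = μ ^ 2 * x ^ 2 + (t * x + 2) ^ 2 := by simp [hQ]
    rw [h]
    rcases eq_or_ne x 0 with rfl | h0
    · norm_num
    · positivity
  have hQ0 : Q ≠ 0 := by
    intro h
    rw [h] at hx
    simp at hx
  have hden : (normalForm μ t).denom.eval x ≠ 0 := by
    intro h
    obtain ⟨c, hc⟩ := RatFunc.denom_div_dvd P Q
    have : Q.eval x = 0 := by
      have h' : ((algebraMap ℝ[X] (RatFunc ℝ) P / algebraMap ℝ[X] (RatFunc ℝ) Q).denom).eval x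
        = 0 := h
      rw [hc, eval_mul, h', zero_mul]
    exact hx.ne' this
  have key : (normalForm μ t).num * Q = P * (normalForm μ t).denom :=
    (RatFunc.num_mul_eq_mul_denom_iff hQ0).2 rfl
  have kx := congrArg (eval x) key
  simp only [eval_mul] at kx
  have hval : (normalForm μ t).num.eval x / (normalForm μ t).denom.eval x = normalFun μ t x := by
    rw [div_eq_iff hden]
    have hPx : P.eval x = 2 * μ * x * (t * x + 2) := by simp [hP]
    have hQx : Q.eval x = μ ^ 2 * x ^ 2 + (t * x + 2) ^ 2 := by simp [hQ]
    rw [normalFun, ← hPx, ← hQx, div_mul_eq_mul_div, eq_div_iff hx.ne', kx]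
  simp [circleMap, hden, hval]

/-- The parameter domain `U₁`. -/
def U₁ : Set (ℝ × ℝ) := {p | 0 < p.1 ∧ 0 < p.2 ∧ 2 - p.1 < p.2 ∧ p.2 < 2}

/-- The parameter domain `U₂`, including its boundary line `μ = t - 2`. -/
def U₂ : Set (ℝ × ℝ) := {p | p.1 < 0 ∧ p.2 < 0 ∧ p.2 - 2 ≤ p.1 ∧ p.1 < -|p.2 + 2|}

/-- The parameter domain `U₃`. -/
def U₃ : Set (ℝ × ℝ) := {p | p.1 < 0 ∧ p.2 < 0 ∧ p.1 < min (p.2 - 2) (1 - p.2 ^ 2 / 4)}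

/-- `f` is a continuous self-map of `[a, b]` with exactly two laps. -/
def IsUnimodalOn (f : ℝ → ℝ) (a b : ℝ) : Prop :=
  MapsTo f (Icc a b) (Icc a b) ∧ ContinuousOn f (Icc a b) ∧
    ∃ c ∈ Ioo a b,
      (StrictMonoOn f (Icc a c) ∧ StrictAntiOn f (Icc c b)) ∨
      (StrictAntiOn f (Icc a c) ∧ StrictMonoOn f (Icc c b))

/-- `f` is a continuous self-map of `[a, b]` with exactly three laps, on which it is increasing,
decreasing and increasing respectively: a `(+-+)`-bimodal map. -/
def IsPlusMinusPlusBimodalOn (f : ℝ → ℝ) (a b : ℝ) : Prop :=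
  MapsTo f (Icc a b) (Icc a b) ∧ ContinuousOn f (Icc a b) ∧
    ∃ c d : ℝ, a < c ∧ c < d ∧ d < b ∧
      StrictMonoOn f (Icc a c) ∧ StrictAntiOn f (Icc c d) ∧ StrictMonoOn f (Icc d b)

end RealQuadratic

end

/-! Every real quadratic rational map is `A⁻¹ ∘ h ∘ B` with Möbius `A`, `B` and `h = x/(x² - 1)` or
`h = x/(x² + 1)` (`exists_normal`). In the first case `f` is a two-to-one covering of the circle,
with entropy `log 2` (`topEntropy_covering`). In the second case a conjugation puts the critical
values at `±1`: `f` becomes `2uv/(u² + v²)` for independent linear forms `u`, `v`. Its image is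
`[-1, 1]`, its critical points are the zeros of `v - u` and `v + u`, and the sign of its derivative
is that of `det · (v² - u²)`.

If no critical point lies in `(-1, 1)`, the map is monotone on `[-1, 1]` and the entropy is `0`.
Otherwise the intermediate value theorem gives a fixed point in `(-1, 1)`. A Möbius map fixing `±1`
moves it to `0`, which yields `f_{μ,t}`; here `μ` is the multiplier of the fixed point `0`.
Conjugation by `x ↦ -x` changes the sign of `t`.

For `μ > 0` and `t ≥ 0` the map is odd (`t = 0`, entropy `0`), or monotone on `[-1, 1]` (`μ + t ≤
2`), or in `U₁`, or has a full horseshoe on `[-1, 0]` (`t ≥ 2`, entropy `log 2`). For `μ < 0` and `t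
≤ 0` it is odd, or monotone on `[-1, 1]` (`μ + t ≥ -2`), or in `U₂ ∪ U₃`, or has a fixed point in
`(-1, 1)` with positive multiplier; moving that point to `0` reduces to `μ > 0`.

Entropy is bounded above by counting preimages under iterates (`topEntropy_le_log`) and below by
separating points with different itineraries (`log_two_le_topEntropy`). -/

noncomputable section

namespace RealQuadratic

open Filter Topology Uniformity Dynamics

/-! ### Entropy, semiconjugacy and growth rates. -/

section Entropy

variable {X Y : Type*} [TopologicalSpace X] [CompactSpace X] [T2Space X]
  [TopologicalSpace Y] [CompactSpace Y] [T2Space Y]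

theorem topEntropy_nonneg [Nonempty X] (T : X → X) : 0 ≤ topEntropy T := by
  let : UniformSpace X := uniformSpaceOfCompactR1
  exact coverEntropy_nonneg T univ_nonempty

theorem topEntropy_le_of_semiconj {S : X → X} {T : Y → Y} (φ : X → Y) (hφ : Continuous φ)
    (hs : Function.Surjective φ) (h : Function.Semiconj φ S T) : topEntropy T ≤ topEntropy S := by
  let : UniformSpace X := uniformSpaceOfCompactR1
  let : UniformSpace Y := uniformSpaceOfCompactR1
  have := coverEntropy_image_le_of_uniformContinuous h
    (CompactSpace.uniformContinuous_of_continuous hφ) univ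
  rwa [image_univ, hs.range_eq] at this

theorem topEntropy_congr {S : X → X} {T : Y → Y} (φ : X ≃ₜ Y)
    (h : ∀ x, φ (S x) = T (φ x)) : topEntropy S = topEntropy T := by
  refine le_antisymm (topEntropy_le_of_semiconj φ.symm φ.symm.continuous φ.symm.surjective ?_)
    (topEntropy_le_of_semiconj φ φ.continuous φ.surjective h)
  intro y
  rw [φ.symm_apply_eq, h, φ.apply_symm_apply]

/-- The exponential growth rate of a polynomial times a geometric sequence. -/
theorem expGrowthSup_poly_mul_pow_le {u : ℕ → ENNReal} (K a : ℕ) (ha : 1 ≤ a)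
    (hu : ∀ n, u n ≤ ((K * (n + 1) ^ 3 * a ^ n : ℕ) : ENNReal)) :
    ExpGrowth.expGrowthSup u ≤ ((Real.log a : ℝ) : EReal) := by
  have ha0 : (0 : ℝ) < a := by exact_mod_cast ha
  rw [ExpGrowth.expGrowthSup_le_iff]
  intro b hb
  obtain ⟨c, hc1, hc2⟩ := EReal.lt_iff_exists_real_btwn.1 hb
  have hc1 : Real.log a < c := by exact_mod_cast hc1
  have key : ∀ᶠ n : ℕ in atTop, (K : ℝ) * ((n : ℝ) + 1) ^ 3 ≤ Real.exp ((c - Real.log a) * n) := by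
    have h1 : (fun x : ℝ => x ^ 3) =o[atTop] fun x => Real.exp ((c - Real.log a) * x) :=
      isLittleO_pow_exp_pos_mul_atTop 3 (sub_pos.2 hc1)
    have h2 := (h1.comp_tendsto (tendsto_natCast_atTop_atTop (R := ℝ))).bound
      (c := 1 / (8 * (K + 1))) (by positivity)
    filter_upwards [h2, eventually_ge_atTop 1] with n hn hn1
    have hn1 : (1 : ℝ) ≤ n := by exact_mod_cast hn1
    simp only [Function.comp, Real.norm_eq_abs, abs_pow, Nat.abs_cast, Real.abs_exp] at hn
    have h3 : ((n : ℝ) + 1) ^ 3 ≤ (2 * n) ^ 3 := by gcongr; linarith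
    have h4 : (K : ℝ) * ((n : ℝ) + 1) ^ 3 ≤ (8 * (K + 1)) * (n : ℝ) ^ 3 := by
      have : (0 : ℝ) ≤ (n : ℝ) ^ 3 := by positivity
      have hK : (0 : ℝ) ≤ K := by positivity
      nlinarith
    refine h4.trans ?_
    rw [one_div, inv_mul_eq_div, le_div_iff₀ (by positivity)] at hn
    linarith
  filter_upwards [key] with n hn
  refine (hu n).trans ?_
  have h1 : ((K * (n + 1) ^ 3 * a ^ n : ℕ) : ℝ) ≤ Real.exp (c * n) := by
    have : c * n = (c - Real.log a) * n + n * Real.log a := by ring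
    rw [this, Real.exp_add, Real.exp_nat_mul, Real.exp_log ha0]
    push_cast
    gcongr
  have h2 : EReal.exp ((c : EReal) * n) ≤ EReal.exp (b * n) := by
    gcongr
  refine le_trans ?_ h2
  have h3 : ((c : EReal) * n) = ((c * n : ℝ) : EReal) := by norm_cast
  rw [h3, EReal.exp_coe, ← ENNReal.ofReal_natCast]
  exact ENNReal.ofReal_le_ofReal h1

/-! ### Upper bounds for entropy by counting preimages. -/

/-- Any point of the circle `ℝ ∪ {∞}` has arbitrarily small open neighbourhoods with finite
frontier. -/
theorem exists_isOpen_finite_frontier (p : OnePoint ℝ) {W : Set (OnePoint ℝ)} (hW : W ∈ 𝓝 p) :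
    ∃ V ⊆ W, IsOpen V ∧ p ∈ V ∧ (frontier V).Finite := by
  induction p with
  | infty =>
    rw [OnePoint.hasBasis_nhds_infty.mem_iff] at hW
    obtain ⟨s, ⟨hs1, hs2⟩, hs⟩ := hW
    obtain ⟨R, hR⟩ := hs2.isBounded.subset_closedBall 0
    rw [Real.closedBall_eq_Icc, zero_sub, zero_add] at hR
    refine ⟨((↑) '' (Icc (-R) R))ᶜ, ?_, ?_, ?_, ?_⟩
    · refine Subset.trans ?_ hs
      intro x hx
      induction x with
      | infty => simp
      | coe x =>
        left
        refine ⟨x, fun hxs => hx ⟨x, hR hxs, rfl⟩, rfl⟩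
    · exact OnePoint.isOpen_compl_image_coe.2 ⟨isClosed_Icc, isCompact_Icc⟩
    · simp
    · rw [frontier_compl]
      have hcl : IsClosed (((↑) : ℝ → OnePoint ℝ) '' Icc (-R) R) :=
        OnePoint.isClosed_image_coe.2 ⟨isClosed_Icc, isCompact_Icc⟩
      rw [hcl.frontier_eq]
      refine (((Set.finite_singleton (-R)).insert R).image ((↑) : ℝ → OnePoint ℝ)).subset ?_
      rintro _ ⟨⟨x, hx, rfl⟩, hx2⟩
      refine ⟨x, ?_, rfl⟩
      by_contra hne
      simp only [mem_insert_iff, mem_singleton_iff, not_or] at hne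
      apply hx2
      refine mem_interior.2 ⟨(↑) '' Ioo (-R) R, image_mono Ioo_subset_Icc_self,
        OnePoint.isOpen_image_coe.2 isOpen_Ioo, ⟨x, ⟨lt_of_le_of_ne hx.1 (Ne.symm hne.2),
          lt_of_le_of_ne hx.2 hne.1⟩, rfl⟩⟩
  | coe x =>
    have hW' : ((↑) : ℝ → OnePoint ℝ) ⁻¹' W ∈ 𝓝 x :=
      OnePoint.continuous_coe.continuousAt.preimage_mem_nhds hW
    obtain ⟨a, b, hx, hab⟩ := mem_nhds_iff_exists_Ioo_subset.1 hW'
    refine ⟨(↑) '' Ioo a b, image_subset_iff.2 hab, OnePoint.isOpen_image_coe.2 isOpen_Ioo,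
      ⟨x, hx, rfl⟩, ?_⟩
    have hcl : IsClosed (((↑) : ℝ → OnePoint ℝ) '' Icc a b) :=
      OnePoint.isClosed_image_coe.2 ⟨isClosed_Icc, isCompact_Icc⟩
    refine (((Set.finite_singleton a).insert b).image ((↑) : ℝ → OnePoint ℝ)).subset ?_
    rw [(OnePoint.isOpen_image_coe.2 isOpen_Ioo).frontier_eq]
    rintro y ⟨hy1, hy2⟩
    obtain ⟨z, hz, rfl⟩ := closure_minimal (image_mono Ioo_subset_Icc_self) hcl hy1
    refine ⟨z, ?_, rfl⟩
    by_contra hne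
    simp only [mem_insert_iff, mem_singleton_iff, not_or] at hne
    exact hy2 ⟨z, ⟨lt_of_le_of_ne hz.1 (Ne.symm hne.2), lt_of_le_of_ne hz.2 hne.1⟩, rfl⟩

/-- The circle can be cut at finitely many points into connected pieces that are small with
respect to a given entourage. -/
theorem exists_finite_cut {U : Set (OnePoint ℝ × OnePoint ℝ)}
    (ht : ∀ p : OnePoint ℝ, ∃ W ∈ 𝓝 p, W ×ˢ W ⊆ U) :
    ∃ E : Set (OnePoint ℝ), E.Finite ∧ ∀ A, IsPreconnected A → Disjoint A E → A ×ˢ A ⊆ U := by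
  choose W hW hWU using ht
  choose V hVW hVo hV hVf using fun p => exists_isOpen_finite_frontier p (hW p)
  obtain ⟨t, ht⟩ := CompactSpace.elim_nhds_subcover V fun p => (hVo p).mem_nhds (hV p)
  refine ⟨⋃ p ∈ t, frontier (V p), t.finite_toSet.biUnion fun p _ => hVf p, ?_⟩
  rintro A hA hd ⟨x, y⟩ ⟨hx, hy⟩
  have hx' : x ∈ ⋃ p ∈ t, V p := by rw [ht]; trivial
  simp only [mem_iUnion] at hx'
  obtain ⟨p, hp, hxp⟩ := hx'
  have hsub : A ⊆ V p := by
    refine hA.subset_left_of_subset_union (hVo p) isClosed_closure.isOpen_compl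
      (disjoint_compl_right.mono_right (compl_subset_compl.2 subset_closure)) ?_ ⟨x, hx, hxp⟩
    intro z hz
    by_cases hzV : z ∈ V p
    · exact Or.inl hzV
    · right
      intro hzc
      refine disjoint_left.1 hd hz ?_
      simp only [mem_iUnion]
      exact ⟨p, hp, by rw [(hVo p).frontier_eq]; exact ⟨hzc, hzV⟩⟩
  exact hWU p ⟨hVW p (hsub hx), hVW p (hsub hy)⟩

end Entropy

/-- A dynamical cover of the circle whose size is controlled by the number of preimages of a
cutting set. -/
theorem exists_isDynCoverOf_card_le [UniformSpace (OnePoint ℝ)] {T : OnePoint ℝ → OnePoint ℝ}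
    (hT : Continuous T) {U : Set (OnePoint ℝ × OnePoint ℝ)} (hU : U ∈ 𝓤 (OnePoint ℝ))
    {E : Set (OnePoint ℝ)} (hE : ∀ A, IsPreconnected A → Disjoint A E → A ×ˢ A ⊆ U)
    (n : ℕ) (G : Finset (OnePoint ℝ)) (hG : ∀ i < n, T^[i] ⁻¹' E ⊆ G) :
    ∃ s : Finset (OnePoint ℝ), IsDynCoverOf T univ U n s ∧ s.card ≤ 2 * G.card + 2 := by
  classical
  set F : Finset ℝ := G.preimage (↑) OnePoint.coe_injective.injOn with hF
  have hFG : F.card ≤ G.card := by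
    rw [← Finset.card_image_of_injective F OnePoint.coe_injective]
    refine Finset.card_le_card ?_
    rw [Finset.image_subset_iff]
    intro x hx
    exact Finset.mem_preimage.1 hx
  let rank : ℝ → ℕ := fun x => (F.filter (· < x)).card
  -- One representative for each gap of `F`, the gaps being indexed by the number of points of `F`
  -- to their left. The value `0` for ranks that do not occur is harmless: it can only add a
  -- superfluous point to the cover.
  let rep : ℕ → ℝ := fun r => if h : ∃ x, x ∉ F ∧ rank x = r then h.choose else 0
  have hrep : ∀ x ∉ F, rep (rank x) ∉ F ∧ rank (rep (rank x)) = rank x := by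
    intro x hx
    have h : ∃ y, y ∉ F ∧ rank y = rank x := ⟨x, hx, rfl⟩
    have : rep (rank x) = h.choose := dif_pos h
    rw [this]
    exact h.choose_spec
  have hlt : ∀ x y f, f ∈ F → x < f → f < y → rank x < rank y := by
    intro x y f hf hxf hfy
    refine Finset.card_lt_card ⟨?_, ?_⟩
    · intro z hz
      simp only [Finset.mem_filter] at hz ⊢
      exact ⟨hz.1, hz.2.trans (hxf.trans hfy)⟩
    · intro h
      have := h (Finset.mem_filter.2 ⟨hf, hfy⟩)
      simp only [Finset.mem_filter] at this
      exact lt_asymm this.2 hxf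
  have hgap : ∀ x y, x < y → x ∉ F → y ∉ F → rank x = rank y → ∀ z ∈ Icc x y, z ∉ F := by
    intro x y _ hx hy hr z hz hzF
    have h1 : x < z := lt_of_le_of_ne hz.1 fun h => hx (h ▸ hzF)
    have h2 : z < y := lt_of_le_of_ne hz.2 fun h => hy (h ▸ hzF)
    exact (hlt x y z hzF h1 h2).ne hr
  have hgap' : ∀ x y, x ∉ F → y ∉ F → rank x = rank y → ∀ z ∈ uIcc x y, z ∉ F := by
    intro x y hx hy hr
    rcases lt_trichotomy x y with h | h | h
    · rw [uIcc_of_le h.le]; exact hgap x y h hx hy hr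
    · subst h
      intro z hz
      rw [uIcc_self, mem_singleton_iff] at hz
      rwa [hz]
    · rw [uIcc_of_ge h.le]; exact hgap y x h hy hx hr.symm
  refine ⟨insert OnePoint.infty (G ∪ (Finset.range (F.card + 1)).image fun r => (rep r : OnePoint ℝ)),
    ?_, ?_⟩
  · intro p _
    have hself : ∀ q : OnePoint ℝ, (q, q) ∈ dynEntourage T U n := fun q =>
      mem_dynEntourage.2 fun k _ => refl_mem_uniformity hU
    by_cases hpG : p ∈ G
    · exact ⟨p, by simp [hpG], hself p⟩
    induction p with
    | infty => exact ⟨OnePoint.infty, by simp, hself _⟩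
    | coe x =>
      have hxF : x ∉ F := fun h => hpG (Finset.mem_preimage.1 h)
      obtain ⟨h1, h2⟩ := hrep x hxF
      refine ⟨(rep (rank x) : OnePoint ℝ), ?_, ?_⟩
      · have hr : rank x < F.card + 1 := Nat.lt_succ_of_le (Finset.card_filter_le _ _)
        simp only [Finset.coe_insert, Finset.coe_union, Finset.coe_image, Finset.coe_range]
        exact Or.inr (Or.inr ⟨rank x, hr, rfl⟩)
      · rw [mem_dynEntourage]
        intro k hk
        -- The segment from `x` to its representative misses `G`, so its images under the first
        -- iterates are connected sets that miss `E`, hence `U`-small.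
        have hpre : IsPreconnected (T^[k] '' (((↑) : ℝ → OnePoint ℝ) '' uIcc x (rep (rank x)))) :=
          (isPreconnected_uIcc.image _ OnePoint.continuous_coe.continuousOn).image _
            (hT.iterate k).continuousOn
        refine hE _ hpre ?_ ⟨⟨_, ⟨x, left_mem_uIcc, rfl⟩, rfl⟩, ⟨_, ⟨_, right_mem_uIcc, rfl⟩, rfl⟩⟩
        rw [disjoint_left]
        rintro _ ⟨_, ⟨z, hz, rfl⟩, rfl⟩ hzE
        exact hgap' x _ hxF h1 h2.symm z hz (Finset.mem_preimage.2 (hG k hk hzE))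
  · refine (Finset.card_insert_le _ _).trans ?_
    have h1 := Finset.card_union_le G
      ((Finset.range (F.card + 1)).image fun r => (rep r : OnePoint ℝ))
    have h2 : ((Finset.range (F.card + 1)).image fun r => (rep r : OnePoint ℝ)).card ≤ F.card + 1 :=
      Finset.card_image_le.trans (by simp)
    omega

/-- A continuous self-map of the circle such that the points have at most `(n + 1)² aⁿ` preimages
under its `n`-th iterate has entropy at most `log a`. -/
theorem topEntropy_le_log {T : OnePoint ℝ → OnePoint ℝ} (hT : Continuous T) {a : ℕ} (ha : 1 ≤ a)
    (h : ∀ n p, (T^[n] ⁻¹' {p}).encard ≤ ((n + 1) ^ 2 * a ^ n : ℕ)) :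
    topEntropy T ≤ ((Real.log a : ℝ) : EReal) := by
  classical
  let : UniformSpace (OnePoint ℝ) := uniformSpaceOfCompactR1
  change (⨆ U ∈ 𝓤 (OnePoint ℝ), coverEntropyEntourage T univ U) ≤ _
  refine iSup₂_le fun U hU => ?_
  obtain ⟨E, hEf, hE⟩ := exists_finite_cut (U := U) fun p => by
    obtain ⟨V, hV, hVs, hVU⟩ := comp_symm_mem_uniformity_sets hU
    refine ⟨UniformSpace.ball p V, UniformSpace.ball_mem_nhds p hV, ?_⟩
    rintro ⟨x, y⟩ ⟨hx, hy⟩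
    exact hVU ⟨p, hVs.symm _ _ hx, hy⟩
  have hfin : ∀ n p, (T^[n] ⁻¹' {p}).Finite := fun n p =>
    finite_of_encard_le_coe (h n p)
  have hcard : ∀ n p, (hfin n p).toFinset.card ≤ (n + 1) ^ 2 * a ^ n := by
    intro n p
    have := h n p
    rw [(hfin n p).encard_eq_coe_toFinset_card] at this
    exact_mod_cast this
  set e := hEf.toFinset.card with he
  -- The cut set `G` collects the preimages of the `e` points of `E` at all times below `n`: `n`
  -- terms of size at most `e (n + 1)² aⁿ` give the cube, and the cover size `2|G| + 2` gives the
  -- constant.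
  refine expGrowthSup_poly_mul_pow_le (2 * e + 2) a ha fun n => ?_
  let G : Finset (OnePoint ℝ) :=
    (Finset.range n).biUnion fun i => hEf.toFinset.biUnion fun p => (hfin i p).toFinset
  have hGcard : G.card ≤ e * ((n + 1) ^ 3 * a ^ n) := by
    have h1 : ∀ i ∈ Finset.range n, (hEf.toFinset.biUnion fun p => (hfin i p).toFinset).card
        ≤ e * ((n + 1) ^ 2 * a ^ n) := by
      intro i hi
      refine Finset.card_biUnion_le_card_mul _ _ _ fun p _ => (hcard i p).trans ?_
      have := Finset.mem_range.1 hi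
      gcongr
    refine (Finset.card_biUnion_le_card_mul _ _ _ h1).trans ?_
    rw [Finset.card_range]
    calc n * (e * ((n + 1) ^ 2 * a ^ n)) ≤ (n + 1) * (e * ((n + 1) ^ 2 * a ^ n)) := by
          gcongr; omega
      _ = _ := by ring
  obtain ⟨s, hs, hsc⟩ := exists_isDynCoverOf_card_le hT hU hE n G (by
    intro i hi x hx
    simp only [G, Finset.coe_biUnion, mem_iUnion, Finset.mem_coe, Finset.mem_range,
      Finite.coe_toFinset]
    exact ⟨i, hi, T^[i] x, hx, rfl⟩)
  have h2 : s.card ≤ (2 * e + 2) * (n + 1) ^ 3 * a ^ n := by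
    have h3 : 1 ≤ (n + 1) ^ 3 * a ^ n := Nat.mul_pos (by positivity) (pow_pos ha n)
    calc s.card ≤ 2 * G.card + 2 := hsc
      _ ≤ 2 * (e * ((n + 1) ^ 3 * a ^ n)) + 2 * ((n + 1) ^ 3 * a ^ n) := by omega
      _ = _ := by ring
  have h4 : coverMincard T univ U n ≤ (((2 * e + 2) * (n + 1) ^ 3 * a ^ n : ℕ) : ℕ∞) :=
    hs.coverMincard_le_card.trans (by exact_mod_cast h2)
  have h5 := ENat.toENNReal_mono h4
  rwa [ENat.toENNReal_coe] at h5

theorem encard_biUnion_le_card_mul {α β : Type*} (s : Finset α) {f : α → Set β} {c : ℕ}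
    (h : ∀ q ∈ s, (f q).encard ≤ c) : (⋃ q ∈ s, f q).encard ≤ (s.card * c : ℕ) := by
  classical
  induction s using Finset.induction_on with
  | empty => simp
  | insert a s ha ih =>
    rw [Finset.set_biUnion_insert, Finset.card_insert_of_notMem ha]
    refine (encard_union_le _ _).trans ?_
    have h1 := h a (Finset.mem_insert_self a s)
    have h2 := ih fun q hq => h q (Finset.mem_insert_of_mem hq)
    calc _ ≤ ((c : ℕ) : ℕ∞) + ((s.card * c : ℕ) : ℕ∞) := add_le_add h1 h2
      _ = _ := by push_cast; ring

/-- A map whose points have at most two preimages has entropy at most `log 2`. -/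
theorem topEntropy_le_log_two {T : OnePoint ℝ → OnePoint ℝ} (hT : Continuous T)
    (h : ∀ p, (T ⁻¹' {p}).encard ≤ 2) : topEntropy T ≤ ((Real.log 2 : ℝ) : EReal) := by
  have key : ∀ n p, (T^[n] ⁻¹' {p}).encard ≤ (2 ^ n : ℕ) := by
    intro n
    induction n with
    | zero => intro p; simp
    | succ n ih =>
      intro p
      have hfin : (T ⁻¹' {p}).Finite := finite_of_encard_le_coe (k := 2) (h p)
      have : T^[n + 1] ⁻¹' {p} = ⋃ q ∈ hfin.toFinset, T^[n] ⁻¹' {q} := by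
        ext x
        simp only [mem_preimage, mem_singleton_iff, mem_iUnion, Finite.mem_toFinset,
          Function.iterate_succ_apply']
        exact ⟨fun h => ⟨_, h, rfl⟩, fun ⟨q, hq, hx⟩ => hx ▸ hq⟩
      rw [this]
      refine (encard_biUnion_le_card_mul _ fun q _ => ih q).trans ?_
      have hc : hfin.toFinset.card ≤ 2 := by
        have := h p
        rw [hfin.encard_eq_coe_toFinset_card] at this
        exact_mod_cast this
      rw [pow_succ, mul_comm (2 ^ n)]
      exact_mod_cast Nat.mul_le_mul_right _ hc
  have := topEntropy_le_log hT (a := 2) (by norm_num) fun n p => (key n p).trans (by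
    exact_mod_cast Nat.le_mul_of_pos_left _ (by positivity))
  exact_mod_cast this

/-- Let `I` be a set containing the image of `T`, and `K ⊆ I` an invariant set such that `T` is
injective on `K` and on `I \ K`. If the fibres of `T` have at most two points, the entropy of `T`
vanishes. -/
theorem topEntropy_eq_zero_of_injOn {T : OnePoint ℝ → OnePoint ℝ} (hT : Continuous T)
    (h : ∀ p, (T ⁻¹' {p}).encard ≤ 2) {I K : Set (OnePoint ℝ)} (hI : ∀ x, T x ∈ I)
    (hK : MapsTo T K K) (h1 : InjOn T K) (h2 : InjOn T (I \ K)) : topEntropy T = 0 := by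
  refine le_antisymm ?_ (topEntropy_nonneg T)
  have hKn : ∀ n, InjOn T^[n] K := fun n => by
    induction n with
    | zero => exact injOn_id _
    | succ n ih => exact ih.comp h1 hK
  -- The preimages in `I` grow by at most one per step: `K` contains at most one, as `T^[n + 1]` is
  -- injective there, and `T` sends the others injectively to preimages of the previous level.
  have hIn : ∀ n p, (T^[n] ⁻¹' {p} ∩ I).encard ≤ (n + 1 : ℕ) := by
    intro n
    induction n with
    | zero =>
      intro p
      exact (encard_le_encard inter_subset_left).trans (by simp)
    | succ n ih =>
      intro p
      have hsub : T^[n + 1] ⁻¹' {p} ∩ I ⊆ (T^[n + 1] ⁻¹' {p} ∩ K) ∪ (T^[n + 1] ⁻¹' {p} ∩ (I \ K)) := by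
        rintro x ⟨hx, hxI⟩
        by_cases hxK : x ∈ K
        · exact Or.inl ⟨hx, hxK⟩
        · exact Or.inr ⟨hx, hxI, hxK⟩
      refine (encard_le_encard hsub).trans ((encard_union_le _ _).trans ?_)
      have e1 : (T^[n + 1] ⁻¹' {p} ∩ K).encard ≤ 1 := by
        rw [encard_le_one_iff]
        rintro x y ⟨hx, hxK⟩ ⟨hy, hyK⟩
        exact hKn (n + 1) hxK hyK ((hx : _ = p).trans (hy : _ = p).symm)
      have e2 : (T^[n + 1] ⁻¹' {p} ∩ (I \ K)).encard ≤ (n + 1 : ℕ) := by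
        refine le_trans ?_ (ih p)
        refine encard_le_encard_of_injOn (f := T) ?_ (h2.mono inter_subset_right)
        rintro x ⟨hx, _⟩
        exact ⟨hx, hI x⟩
      calc _ ≤ 1 + ((n + 1 : ℕ) : ℕ∞) := add_le_add e1 e2
        _ = _ := by push_cast; ring
  have key : ∀ n p, (T^[n] ⁻¹' {p}).encard ≤ ((n + 1) ^ 2 * 1 ^ n : ℕ) := by
    intro n p
    rcases n with _ | n
    · simp
    have hfin : (T^[n] ⁻¹' {p} ∩ I).Finite := finite_of_encard_le_coe (hIn n p)
    have hc : hfin.toFinset.card ≤ n + 1 := by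
      have := hIn n p
      rw [hfin.encard_eq_coe_toFinset_card] at this
      exact_mod_cast this
    have : T^[n + 1] ⁻¹' {p} = ⋃ q ∈ hfin.toFinset, T ⁻¹' {q} := by
      ext x
      simp [hI x]
    rw [this]
    refine (encard_biUnion_le_card_mul (c := 2) _ fun q _ => h q).trans ?_
    have h3 : hfin.toFinset.card * 2 ≤ (n + 1 + 1) ^ 2 * 1 ^ (n + 1) := by
      rw [one_pow]; nlinarith
    exact_mod_cast h3
  have := topEntropy_le_log hT (a := 1) le_rfl key
  simpa using this

/-! ### Lower bounds for entropy by itineraries. -/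

/-- The iterated preimage of `z` with itinerary described by `S`, where `g₀` and `g₁` are two
branches of the inverse of a map. -/
def wordPoint {X : Type*} (z : X) (g₀ g₁ : X → X) (S : Finset ℕ) : ℕ → X
  | 0 => z
  | j + 1 => if j ∈ S then g₁ (wordPoint z g₀ g₁ S j) else g₀ (wordPoint z g₀ g₁ S j)

/-- Two different itineraries have a first difference, at some position `j`. At time `n - (j + 1)`
the two orbits are then the images of one point under `g₀` and `g₁`, which `U` separates. The
letters at multiples of `k` are fixed to `g₀`, which costs at most `m` of the `k * m` binary
choices. -/
theorem exists_isDynNetIn_of_wordPoint {X : Type*} {T : X → X} {U V : Set (X × X)}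
    (hUr : ∀ x, (x, x) ∈ U) (hV : ∀ x y w, (x, w) ∈ V → (y, w) ∈ V → (x, y) ∈ U) {z : X} {g₀ g₁ : X → X} {k : ℕ}
    (hT : ∀ S j, T (wordPoint z g₀ g₁ S (j + 1)) = wordPoint z g₀ g₁ S j)
    (hU : ∀ S : Finset ℕ, (∀ i ∈ S, ¬ k ∣ i) → ∀ j,
      (g₀ (wordPoint z g₀ g₁ S j), g₁ (wordPoint z g₀ g₁ S j)) ∉ U ∧
      (g₁ (wordPoint z g₀ g₁ S j), g₀ (wordPoint z g₀ g₁ S j)) ∉ U) (m : ℕ) :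
    ∃ s : Finset X, IsDynNetIn T univ V (k * m) s ∧ 2 ^ (k * m - m) ≤ s.card := by
  classical
  set n := k * m
  set A : Finset ℕ := (Finset.range n).filter fun j => ¬ k ∣ j with hA
  have hAc : n - m ≤ A.card := by
    have h1 : ((Finset.range n).filter fun j => k ∣ j).card + A.card = (Finset.range n).card := by
      rw [hA]
      convert Finset.card_filter_add_card_filter_not (s := Finset.range n) (fun j => k ∣ j)
    have h2 : ((Finset.range n).filter fun j => k ∣ j).card ≤ m := by
      have : ((Finset.range n).filter fun j => k ∣ j) ⊆ (Finset.range m).image fun i => k * i := by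
        intro j hj
        simp only [Finset.mem_filter, Finset.mem_range] at hj
        obtain ⟨i, rfl⟩ := hj.2
        exact Finset.mem_image.2 ⟨i, Finset.mem_range.2 (lt_of_mul_lt_mul_left' hj.1), rfl⟩
      exact (Finset.card_le_card this).trans (Finset.card_image_le.trans (by simp))
    rw [Finset.card_range] at h1
    omega
  have hTi : ∀ S i j, T^[i] (wordPoint z g₀ g₁ S (i + j)) = wordPoint z g₀ g₁ S j := by
    intro S i
    induction i with
    | zero => intro j; simp
    | succ i ih =>
      intro j
      rw [Function.iterate_succ_apply, show i + 1 + j = (i + j) + 1 by ring, hT, ih]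
  have hsep : ∀ S ∈ A.powerset, ∀ S' ∈ A.powerset,
      (∀ i < n, (T^[i] (wordPoint z g₀ g₁ S n), T^[i] (wordPoint z g₀ g₁ S' n)) ∈ U) → S = S' := by
    intro S hS S' hS' h
    rw [Finset.mem_powerset] at hS hS'
    have hSk : ∀ i ∈ S, ¬ k ∣ i := fun i hi => (Finset.mem_filter.1 (hS hi)).2
    have hstep : ∀ j < n, wordPoint z g₀ g₁ S j = wordPoint z g₀ g₁ S' j → (j ∈ S ↔ j ∈ S') := by
      intro j hj he
      have h1 := h (n - (j + 1)) (by omega)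
      have h2 := hTi S (n - (j + 1)) (j + 1)
      have h3 := hTi S' (n - (j + 1)) (j + 1)
      rw [Nat.sub_add_cancel (by omega)] at h2 h3
      rw [h2, h3] at h1
      simp only [wordPoint, ← he] at h1
      by_cases a : j ∈ S <;> by_cases b : j ∈ S' <;> simp only [a, b, if_true, if_false] at h1 ⊢
      · exact ((hU S hSk j).2 h1).elim
      · exact ((hU S hSk j).1 h1).elim
    have heq : ∀ j ≤ n, wordPoint z g₀ g₁ S j = wordPoint z g₀ g₁ S' j := by
      intro j
      induction j with
      | zero => intro _; rfl
      | succ j ih =>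
        intro hj
        have h1 := ih (by omega)
        have h2 := hstep j (by omega) h1
        simp only [wordPoint, h1, h2]
    ext j
    by_cases hj : j < n
    · exact hstep j hj (heq j hj.le)
    · have hnot : ∀ S ⊆ A, j ∉ S := fun S hS hjS =>
        hj (Finset.mem_range.1 (Finset.mem_filter.1 (hS hjS)).1)
      simp [hnot S hS, hnot S' hS']
  refine ⟨A.powerset.image fun S => wordPoint z g₀ g₁ S n, ⟨subset_univ _, ?_⟩, ?_⟩
  · intro x hx y hy hxy
    obtain ⟨S, hS, rfl⟩ := Finset.mem_image.1 hx
    obtain ⟨S', hS', rfl⟩ := Finset.mem_image.1 hy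
    rw [Function.onFun, disjoint_left]
    intro w hw hw'
    refine hxy (congrArg (fun S => wordPoint z g₀ g₁ S n) (hsep S hS S' hS' fun i hi => ?_))
    exact hV _ _ _ (mem_dynEntourage.1 hw i hi) (mem_dynEntourage.1 hw' i hi)
  · rw [Finset.card_image_of_injOn, Finset.card_powerset]
    · exact Nat.pow_le_pow_right (by norm_num) hAc
    · intro S hS S' hS' he
      refine hsep S hS S' hS' fun i _ => ?_
      have he' : wordPoint z g₀ g₁ S n = wordPoint z g₀ g₁ S' n := he
      rw [he']
      exact hUr _

/-- Lower bound for the entropy: it is enough to separate the points whose itineraries have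
prescribed letters in the positions divisible by `k`, for any given `k`. -/
theorem log_two_le_topEntropy {X : Type*} [TopologicalSpace X] [CompactSpace X] [T2Space X]
    {T : X → X} {z : X} {g₀ g₁ : X → X}
    (hT : ∀ S j, T (wordPoint z g₀ g₁ S (j + 1)) = wordPoint z g₀ g₁ S j)
    (h : ∀ k : ℕ, 0 < k → ∃ U : Set (X × X), IsOpen U ∧ (∀ x, (x, x) ∈ U) ∧
      ∀ S : Finset ℕ, (∀ i ∈ S, ¬ k ∣ i) → ∀ j,
        (g₀ (wordPoint z g₀ g₁ S j), g₁ (wordPoint z g₀ g₁ S j)) ∉ U ∧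
        (g₁ (wordPoint z g₀ g₁ S j), g₀ (wordPoint z g₀ g₁ S j)) ∉ U) :
    ((Real.log 2 : ℝ) : EReal) ≤ topEntropy T := by
  -- With one prescribed letter in every block of length `k + 1`, a proportion `k / (k + 1)` of the
  -- letters stays free; this tends to `1`.
  have key : ∀ k : ℕ, (((k : ℝ) / (k + 1) * Real.log 2 : ℝ) : EReal) ≤ topEntropy T := by
    intro k
    obtain ⟨U, hUo, hUr, hU⟩ := h (k + 1) (Nat.succ_pos k)
    let : UniformSpace X := uniformSpaceOfCompactR1
    have hUu : U ∈ 𝓤 X := by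
      rw [compactSpace_uniformity]
      simp only [mem_iSup]
      exact fun x => hUo.mem_nhds (hUr x)
    obtain ⟨V, hVu, hVs, hVU⟩ := comp_symm_mem_uniformity_sets hUu
    refine le_trans ?_ (netEntropyEntourage_le_coverEntropy T univ hVu)
    refine Frequently.le_expGrowthSup ?_
    rw [frequently_atTop]
    intro N
    refine ⟨(k + 1) * N, Nat.le_mul_of_pos_left _ (Nat.succ_pos k), ?_⟩
    obtain ⟨s, hs, hsc⟩ := exists_isDynNetIn_of_wordPoint hUr
      (fun x y w hx hy => hVU ⟨w, hx, hVs.symm _ _ hy⟩) hT hU N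
    have h1 : ((2 ^ (k * N) : ℕ) : ℕ∞) ≤ netMaxcard T univ V ((k + 1) * N) := by
      refine le_trans ?_ hs.card_le_netMaxcard
      rw [show (k + 1) * N - N = k * N by rw [add_mul, one_mul, Nat.add_sub_cancel]] at hsc
      exact_mod_cast hsc
    have h2 := ENat.toENNReal_mono h1
    rw [ENat.toENNReal_coe] at h2
    refine le_trans ?_ h2
    have h3 : (((k : ℝ) / (k + 1) * Real.log 2 : ℝ) : EReal) * (((k + 1) * N : ℕ) : EReal)
        = (((k * N : ℕ) * Real.log 2 : ℝ) : EReal) := by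
      have : ((k * N : ℕ) : ℝ) * Real.log 2
          = ((k : ℝ) / (k + 1) * Real.log 2) * (((k + 1) * N : ℕ) : ℝ) := by
        push_cast
        field_simp
      rw [this, EReal.coe_mul _ (((k + 1) * N : ℕ) : ℝ)]
      rfl
    rw [h3, EReal.exp_coe, Real.exp_nat_mul, Real.exp_log (by norm_num), ← ENNReal.ofReal_natCast]
    push_cast
    exact le_rfl
  have hlim : Tendsto (fun k : ℕ => (((k : ℝ) / (k + 1) * Real.log 2 : ℝ) : EReal)) atTop
      (𝓝 ((Real.log 2 : ℝ) : EReal)) := by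
    refine (continuous_coe_real_ereal.tendsto _).comp ?_
    simpa using (tendsto_natCast_div_add_atTop (1 : ℝ)).mul_const (Real.log 2)
  exact le_of_tendsto' hlim key

/-! ### Homogeneous coordinates, continuity and Möbius transformations. -/

/-- The point of the circle `ℝ ∪ {∞}` with homogeneous coordinates `[x : y]`. -/
def hpt (x y : ℝ) : OnePoint ℝ := if y = 0 then OnePoint.infty else ((x / y : ℝ) : OnePoint ℝ)

theorem hpt_one (x : ℝ) : hpt x 1 = x := by simp [hpt]

theorem hpt_zero (x : ℝ) : hpt x 0 = OnePoint.infty := by simp [hpt]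

theorem hpt_of_ne {x y : ℝ} (hy : y ≠ 0) : hpt x y = ((x / y : ℝ) : OnePoint ℝ) := by simp [hpt, hy]

theorem exists_hpt (p : OnePoint ℝ) : ∃ x y : ℝ, (x ≠ 0 ∨ y ≠ 0) ∧ hpt x y = p := by
  induction p with
  | infty => exact ⟨1, 0, by simp, hpt_zero 1⟩
  | coe x => exact ⟨x, 1, by simp, hpt_one x⟩

theorem hpt_mul {c : ℝ} (hc : c ≠ 0) (x y : ℝ) : hpt (c * x) (c * y) = hpt x y := by
  by_cases hy : y = 0
  · simp [hpt, hy]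
  · rw [hpt_of_ne hy, hpt_of_ne (mul_ne_zero hc hy), mul_div_mul_left _ _ hc]

theorem hpt_eq_iff {x y x' y' : ℝ} (h : x ≠ 0 ∨ y ≠ 0) (h' : x' ≠ 0 ∨ y' ≠ 0) :
    hpt x y = hpt x' y' ↔ x * y' = x' * y := by
  by_cases hy : y = 0 <;> by_cases hy' : y' = 0
  · simp [hpt, hy, hy']
  · have : x ≠ 0 := by tauto
    simp [hpt, hy, hy', this]
  · have : x' ≠ 0 := by tauto
    simp [hpt, hy, hy', this]
  · rw [hpt_of_ne hy, hpt_of_ne hy', OnePoint.coe_eq_coe, div_eq_div_iff hy hy']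

/-- The invertible matrix with the given rows. -/
def gl (a b c d : ℝ) (h : a * d - b * c ≠ 0) : GL (Fin 2) ℝ :=
  Matrix.GeneralLinearGroup.mkOfDetNeZero !![a, b; c, d] (by rwa [Matrix.det_fin_two_of])

theorem smul_hpt (g : GL (Fin 2) ℝ) {x y : ℝ} (h : x ≠ 0 ∨ y ≠ 0) :
    g • hpt x y = hpt (g 0 0 * x + g 0 1 * y) (g 1 0 * x + g 1 1 * y) := by
  by_cases hy : y = 0
  · subst hy
    have hx : x ≠ 0 := by tauto
    simp only [hpt_zero, OnePoint.smul_infty_eq_ite, mul_zero, add_zero]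
    rw [mul_comm _ x, mul_comm _ x, hpt_mul hx, hpt]
  · rw [hpt_of_ne hy, OnePoint.smul_some_eq_ite]
    have h1 : g 0 0 * x + g 0 1 * y = y * (g 0 0 * (x / y) + g 0 1) := by field_simp
    have h2 : g 1 0 * x + g 1 1 * y = y * (g 1 0 * (x / y) + g 1 1) := by field_simp
    rw [h1, h2, hpt_mul hy, hpt]

theorem gl_smul_hpt {a b c d : ℝ} (hg : a * d - b * c ≠ 0) {x y : ℝ} (h : x ≠ 0 ∨ y ≠ 0) :
    gl a b c d hg • hpt x y = hpt (a * x + b * y) (c * x + d * y) := by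
  rw [smul_hpt _ h]
  rfl

theorem linear_ne_zero {a b c d : ℝ} (hg : a * d - b * c ≠ 0) {x y : ℝ} (h : x ≠ 0 ∨ y ≠ 0) :
    a * x + b * y ≠ 0 ∨ c * x + d * y ≠ 0 := by
  by_contra! hcon
  obtain ⟨h1, h2⟩ := hcon
  have hx : (a * d - b * c) * x = 0 := by linear_combination d * h1 - b * h2
  have hy : (a * d - b * c) * y = 0 := by linear_combination a * h2 - c * h1
  rcases h with h | h
  · exact (mul_ne_zero hg h) hx
  · exact (mul_ne_zero hg h) hy

theorem exists_gl (g : GL (Fin 2) ℝ) : ∃ a b c d, ∃ h : a * d - b * c ≠ 0, g = gl a b c d h := by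
  have hdet : g 0 0 * g 1 1 - g 0 1 * g 1 0 ≠ 0 := by
    rw [← Matrix.det_fin_two]
    exact g.det_ne_zero
  refine ⟨g 0 0, g 0 1, g 1 0, g 1 1, hdet, ?_⟩
  ext i j
  fin_cases i <;> fin_cases j <;> rfl

theorem continuousAt_hpt {q : ℝ × ℝ} (h : q.1 ≠ 0 ∨ q.2 ≠ 0) :
    ContinuousAt (fun q : ℝ × ℝ => hpt q.1 q.2) q := by
  by_cases hy : q.2 = 0
  · have hx : q.1 ≠ 0 := by tauto
    rw [ContinuousAt, hy, hpt_zero, OnePoint.hasBasis_nhds_infty.tendsto_right_iff]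
    rintro s ⟨_, hs⟩
    obtain ⟨R, hR⟩ := hs.isBounded.subset_closedBall 0
    have hev : ∀ᶠ q' in 𝓝 q, R * |q'.2| < |q'.1| := by
      have hc1 : Continuous fun q' : ℝ × ℝ => R * |q'.2| := by fun_prop
      have hc2 : Continuous fun q' : ℝ × ℝ => |q'.1| := by fun_prop
      refine hc1.continuousAt.eventually_lt hc2.continuousAt ?_
      simpa [hy] using hx
    filter_upwards [hev] with q' hq'
    by_cases hy' : q'.2 = 0
    · right; rw [hy', hpt_zero]; rfl
    · left
      rw [hpt_of_ne hy']
      refine ⟨_, fun hmem => ?_, rfl⟩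
      have := hR hmem
      rw [mem_closedBall_zero_iff, Real.norm_eq_abs, abs_div, div_le_iff₀ (abs_pos.2 hy')] at this
      linarith
  · have h1 : ContinuousAt (fun q : ℝ × ℝ => ((q.1 / q.2 : ℝ) : OnePoint ℝ)) q :=
      OnePoint.continuous_coe.continuousAt.comp
        (continuousAt_fst.div continuousAt_snd hy)
    refine h1.congr ?_
    filter_upwards [(continuousAt_snd (p := q)).eventually_ne hy] with q' hq'
    rw [hpt_of_ne hq']

/-- Continuity of a self-map of the circle can be checked in the two standard charts. -/
theorem continuous_of_charts {T : OnePoint ℝ → OnePoint ℝ} (h1 : Continuous fun x => T (hpt x 1))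
    (h2 : Continuous fun y => T (hpt 1 y)) : Continuous T := by
  rw [continuous_iff_continuousAt]
  intro p
  induction p with
  | infty =>
    rw [OnePoint.continuousAt_infty', coclosedCompact_eq_cocompact, ← Metric.cobounded_eq_cocompact]
    have h3 : Tendsto (fun y => T (hpt 1 y)) (𝓝 0) (𝓝 (T OnePoint.infty)) := by
      have := h2.tendsto 0
      rwa [hpt_zero] at this
    have h4 : Tendsto (fun x : ℝ => T (hpt 1 x⁻¹)) (Bornology.cobounded ℝ)
        (𝓝 (T OnePoint.infty)) := h3.comp tendsto_inv₀_cobounded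
    refine h4.congr' ?_
    filter_upwards [(Metric.hasBasis_cobounded_compl_closedBall (0 : ℝ)).mem_of_mem trivial (i := 1)]
      with x hx
    have hx0 : x ≠ 0 := by
      rintro rfl
      simp at hx
    simp [hpt, hx0]
  | coe x =>
    rw [OnePoint.continuousAt_coe]
    simp only [hpt_one] at h1
    exact h1.continuousAt

/-- A self-map of the circle given by continuous homogeneous expressions is continuous. -/
theorem continuous_of_hpt {T : OnePoint ℝ → OnePoint ℝ} {P Q : ℝ → ℝ → ℝ}
    (hP : Continuous fun q : ℝ × ℝ => P q.1 q.2) (hQ : Continuous fun q : ℝ × ℝ => Q q.1 q.2)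
    (hne : ∀ x y, (x ≠ 0 ∨ y ≠ 0) → (P x y ≠ 0 ∨ Q x y ≠ 0))
    (hT : ∀ x y, (x ≠ 0 ∨ y ≠ 0) → T (hpt x y) = hpt (P x y) (Q x y)) : Continuous T := by
  have key : ∀ c : ℝ → ℝ × ℝ, Continuous c → (∀ s, (c s).1 ≠ 0 ∨ (c s).2 ≠ 0) →
      Continuous fun s => T (hpt (c s).1 (c s).2) := by
    intro c hc hc0
    rw [continuous_iff_continuousAt]
    intro s
    have h1 : ContinuousAt (fun s => (P (c s).1 (c s).2, Q (c s).1 (c s).2)) s :=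
      ((hP.comp hc).prodMk (hQ.comp hc)).continuousAt
    have h2 := ContinuousAt.comp (f := fun s => (P (c s).1 (c s).2, Q (c s).1 (c s).2))
      (x := s) (continuousAt_hpt (hne _ _ (hc0 s))) h1
    refine h2.congr (Eventually.of_forall fun s => ?_)
    exact (hT _ _ (hc0 s)).symm
  exact continuous_of_charts (key (fun x => (x, 1)) (by fun_prop) (by simp))
    (key (fun y => (1, y)) (by fun_prop) (by simp))

theorem continuous_gl_smul (g : GL (Fin 2) ℝ) : Continuous fun p : OnePoint ℝ => g • p := by
  obtain ⟨a, b, c, d, h, rfl⟩ := exists_gl g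
  exact continuous_of_hpt (P := fun x y => a * x + b * y) (Q := fun x y => c * x + d * y)
    (by fun_prop) (by fun_prop) (fun x y hxy => linear_ne_zero h hxy)
    fun x y hxy => gl_smul_hpt h hxy

/-- The action of an invertible matrix on the circle as a homeomorphism. -/
def glHomeo (g : GL (Fin 2) ℝ) : OnePoint ℝ ≃ₜ OnePoint ℝ where
  toEquiv := MulAction.toPerm g
  continuous_toFun := continuous_gl_smul g
  continuous_invFun := continuous_gl_smul g⁻¹

/-- Conjugacy of self-maps of the circle by a Möbius transformation. -/
def MobiusConj (S T : OnePoint ℝ → OnePoint ℝ) : Prop :=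
  ∃ g : GL (Fin 2) ℝ, ∀ p, g • S p = T (g • p)

theorem MobiusConj.topEntropy_eq {S T : OnePoint ℝ → OnePoint ℝ} (h : MobiusConj S T) :
    topEntropy S = topEntropy T := by
  obtain ⟨g, hg⟩ := h
  exact topEntropy_congr (glHomeo g) hg

theorem MobiusConj.trans {S T R : OnePoint ℝ → OnePoint ℝ} (h : MobiusConj S T)
    (h' : MobiusConj T R) : MobiusConj S R := by
  obtain ⟨g, hg⟩ := h
  obtain ⟨g', hg'⟩ := h'
  exact ⟨g' * g, fun p => by rw [mul_smul, mul_smul, hg, hg']⟩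

/-! ### Quadratic maps up to Möbius transformations on both sides. -/

/-- The self-map of the circle given by a pair of binary quadratic forms. -/
def quadMap (p₀ p₁ p₂ q₀ q₁ q₂ : ℝ) : OnePoint ℝ → OnePoint ℝ := fun p =>
  p.elim (hpt p₂ q₂) fun x => hpt (p₂ * x ^ 2 + p₁ * x + p₀) (q₂ * x ^ 2 + q₁ * x + q₀)

theorem quadMap_hpt (p₀ p₁ p₂ q₀ q₁ q₂ : ℝ) {x y : ℝ} (h : x ≠ 0 ∨ y ≠ 0) :
    quadMap p₀ p₁ p₂ q₀ q₁ q₂ (hpt x y) =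
      hpt (p₂ * x ^ 2 + p₁ * x * y + p₀ * y ^ 2) (q₂ * x ^ 2 + q₁ * x * y + q₀ * y ^ 2) := by
  by_cases hy : y = 0
  · subst hy
    have hx : x ≠ 0 := by tauto
    have h1 : p₂ * x ^ 2 + p₁ * x * 0 + p₀ * 0 ^ 2 = x ^ 2 * p₂ := by ring
    have h2 : q₂ * x ^ 2 + q₁ * x * 0 + q₀ * 0 ^ 2 = x ^ 2 * q₂ := by ring
    rw [h1, h2, hpt_mul (pow_ne_zero 2 hx), hpt_zero]
    rfl
  · have h1 : p₂ * x ^ 2 + p₁ * x * y + p₀ * y ^ 2 = y ^ 2 * (p₂ * (x / y) ^ 2 + p₁ * (x / y) + p₀) := by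
      field_simp
    have h2 : q₂ * x ^ 2 + q₁ * x * y + q₀ * y ^ 2 = y ^ 2 * (q₂ * (x / y) ^ 2 + q₁ * (x / y) + q₀) := by
      field_simp
    rw [h1, h2, hpt_mul (pow_ne_zero 2 hy), hpt_of_ne hy]
    rfl

theorem eval_eq_of_natDegree_le_two {p : ℝ[X]} (h : p.natDegree ≤ 2) (x : ℝ) :
    p.eval x = p.coeff 2 * x ^ 2 + p.coeff 1 * x + p.coeff 0 := by
  rw [eval_eq_sum_range' (Nat.lt_succ_of_le h)]
  simp only [Finset.sum_range_succ, Finset.sum_range_zero]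
  ring

theorem circleMap_eq_quadMap {f : RatFunc ℝ} (hf : ratDegree f = 2) :
    circleMap f = quadMap (f.num.coeff 0) (f.num.coeff 1) (f.num.coeff 2)
      (f.denom.coeff 0) (f.denom.coeff 1) (f.denom.coeff 2) := by
  have h1 : f.num.natDegree ≤ 2 := hf ▸ le_max_left _ _
  have h2 : f.denom.natDegree ≤ 2 := hf ▸ le_max_right _ _
  funext p
  induction p with
  | infty => simp [circleMap, quadMap, hpt, hf]
  | coe x =>
    simp only [circleMap, quadMap, hpt, OnePoint.elim_some, eval_eq_of_natDegree_le_two h1,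
      eval_eq_of_natDegree_le_two h2]

theorem quadForm_ne_zero {f : RatFunc ℝ} (hf : ratDegree f = 2) {x y : ℝ} (h : x ≠ 0 ∨ y ≠ 0) :
    f.num.coeff 2 * x ^ 2 + f.num.coeff 1 * x * y + f.num.coeff 0 * y ^ 2 ≠ 0 ∨
    f.denom.coeff 2 * x ^ 2 + f.denom.coeff 1 * x * y + f.denom.coeff 0 * y ^ 2 ≠ 0 := by
  have h1 : f.num.natDegree ≤ 2 := hf ▸ le_max_left _ _
  have h2 : f.denom.natDegree ≤ 2 := hf ▸ le_max_right _ _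
  by_contra! hcon
  obtain ⟨e1, e2⟩ := hcon
  by_cases hy : y = 0
  · subst hy
    have hx : x ≠ 0 := by tauto
    have c1 : f.num.coeff 2 = 0 := by simpa [hx] using e1
    have c2 : f.denom.coeff 2 = 0 := by simpa [hx] using e2
    rcases max_choice f.num.natDegree f.denom.natDegree with hm | hm <;>
      rw [ratDegree, hm] at hf
    · rw [← hf, coeff_natDegree, leadingCoeff_eq_zero] at c1
      simp [c1] at hf
    · rw [← hf, coeff_natDegree, leadingCoeff_eq_zero] at c2
      simp [c2] at hf
  · have c1 : f.num.eval (x / y) = 0 := by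
      rw [eval_eq_of_natDegree_le_two h1]
      field_simp
      linarith
    have c2 : f.denom.eval (x / y) = 0 := by
      rw [eval_eq_of_natDegree_le_two h2]
      field_simp
      linarith
    obtain ⟨a, b, hab⟩ := f.isCoprime_num_denom
    have := congrArg (eval (x / y)) hab
    simp [c1, c2] at this

/-- If both minors vanished, numerator and denominator would be proportional and `f` constant. These
minors are, up to nonzero factors, combinations of the coefficients of the Wronskian, which is thus
not identically zero. -/
theorem quadForm_minor_ne_zero {f : RatFunc ℝ} (hf : ratDegree f = 2) :
    f.num.coeff 1 * f.denom.coeff 2 ≠ f.num.coeff 2 * f.denom.coeff 1 ∨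
    f.num.coeff 0 * f.denom.coeff 2 ≠ f.num.coeff 2 * f.denom.coeff 0 := by
  have h1 : f.num.natDegree ≤ 2 := hf ▸ le_max_left _ _
  have h2 : f.denom.natDegree ≤ 2 := hf ▸ le_max_right _ _
  by_contra! hcon
  obtain ⟨e1, e2⟩ := hcon
  have hpoly : f.num * C (f.denom.coeff 2) = f.denom * C (f.num.coeff 2) := by
    ext n
    rw [coeff_mul_C, coeff_mul_C]
    rcases n with _ | _ | _ | n
    · rw [e2, mul_comm]
    · rw [zero_add, e1, mul_comm]
    · rw [mul_comm]
    · have c1 : f.num.coeff (n + 1 + 1 + 1) = 0 := coeff_eq_zero_of_natDegree_lt (by omega)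
      have c2 : f.denom.coeff (n + 1 + 1 + 1) = 0 := coeff_eq_zero_of_natDegree_lt (by omega)
      rw [c1, c2, zero_mul, zero_mul]
  have hq2 : f.denom.coeff 2 ≠ 0 := by
    intro h0
    have hp2 : f.num.coeff 2 ≠ 0 := by
      have := quadForm_ne_zero hf (x := 1) (y := 0) (by simp)
      simpa [h0] using this
    rw [h0, C_0, mul_zero, eq_comm, mul_eq_zero, C_eq_zero] at hpoly
    exact hpoly.elim f.denom_ne_zero hp2
  have hd : f.denom ∣ C (f.denom.coeff 2) := by
    refine f.isCoprime_num_denom.symm.dvd_of_dvd_mul_left ⟨_, hpoly⟩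
  have hd0 : f.denom.natDegree = 0 := by
    have := natDegree_le_of_dvd hd (C_ne_zero.2 hq2)
    simpa using this
  have hn0 : f.num.natDegree = 0 := by
    have := congrArg natDegree hpoly
    rw [natDegree_mul_C hq2] at this
    have h3 := natDegree_mul_C_le f.denom (f.num.coeff 2)
    omega
  rw [ratDegree, hn0, hd0] at hf
  simp at hf

/-- Normal form, up to Möbius transformations on both sides, of a pair of quadratic forms such that
the point `0` is not critical. -/
theorem quadMap_normal_of_minor {p₀ p₁ p₂ q₀ q₁ q₂ : ℝ}
    (hne : ∀ x y : ℝ, (x ≠ 0 ∨ y ≠ 0) → p₂ * x ^ 2 + p₁ * x * y + p₀ * y ^ 2 ≠ 0 ∨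
      q₂ * x ^ 2 + q₁ * x * y + q₀ * y ^ 2 ≠ 0) (h : q₀ * p₁ - p₀ * q₁ ≠ 0) :
    ∃ ε : ℝ, (ε = 1 ∨ ε = -1) ∧ ∃ A B : GL (Fin 2) ℝ, ∀ p,
      A • quadMap p₀ p₁ p₂ q₀ q₁ q₂ p = quadMap 0 1 0 ε 0 1 (B • p) := by
  set α := q₀ * p₁ - p₀ * q₁ with hα
  set β := q₀ * p₂ - p₀ * q₂ with hβ
  have hm0 : 0 < p₀ ^ 2 + q₀ ^ 2 := by
    rcases eq_or_ne p₀ 0 with h0 | h0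
    · have : q₀ ≠ 0 := by
        rintro h1
        apply h
        rw [hα, h0, h1]; ring
      positivity
    · positivity
  set m₀ := p₀ ^ 2 + q₀ ^ 2 with hm0'
  set m₁ := p₀ * p₁ + q₀ * q₁ with hm1
  set m₂ := p₀ * p₂ + q₀ * q₂ with hm2
  set r₀ := m₀ / α ^ 2 with hr0
  set r₁ := m₁ / α - 2 * m₀ * β / α ^ 2 with hr1
  set r₂ := m₂ - m₁ * β / α + m₀ * β ^ 2 / α ^ 2 with hr2
  have hr0pos : 0 < r₀ := by positivity
  -- Sending the value at `0` to `0` gives `q₀P - p₀Q = x·w` with `w = αy + βx`. The complementary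
  -- form `p₀P + q₀Q` is rewritten in `x` and `w`. Subtracting `r₁` times `x·w` removes the mixed
  -- term, and a rescaling of `w` then leaves `x² ± w²`.
  have hR : ∀ x y : ℝ, m₂ * x ^ 2 + m₁ * x * y + m₀ * y ^ 2
      = r₂ * x ^ 2 + r₁ * x * (α * y + β * x) + r₀ * (α * y + β * x) ^ 2 := by
    intro x y
    rw [hr0, hr1, hr2]
    field_simp
    ring
  -- If `r₂ = 0`, both forms vanish at the zero `[α : -β]` of `w`, against `hne`.
  have hr2ne : r₂ ≠ 0 := by
    intro h0
    have e1 := hR α (-β)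
    have e2 : α * -β + β * α = 0 := by ring
    rw [e2, h0] at e1
    have e3 : q₀ * (p₂ * α ^ 2 + p₁ * α * -β + p₀ * (-β) ^ 2)
        - p₀ * (q₂ * α ^ 2 + q₁ * α * -β + q₀ * (-β) ^ 2) = 0 := by
      rw [hα, hβ]; ring
    have e4 : p₀ * (p₂ * α ^ 2 + p₁ * α * -β + p₀ * (-β) ^ 2)
        + q₀ * (q₂ * α ^ 2 + q₁ * α * -β + q₀ * (-β) ^ 2) = 0 := by
      rw [hm2, hm1, hm0'] at e1
      linear_combination e1
    generalize hP : p₂ * α ^ 2 + p₁ * α * -β + p₀ * (-β) ^ 2 = P at e3 e4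
    generalize hQ : q₂ * α ^ 2 + q₁ * α * -β + q₀ * (-β) ^ 2 = Q at e3 e4
    have hP0 : m₀ * P = 0 := by rw [hm0']; linear_combination q₀ * e3 + p₀ * e4
    have hQ0 : m₀ * Q = 0 := by rw [hm0']; linear_combination q₀ * e4 - p₀ * e3
    rcases hne α (-β) (Or.inl h) with h1 | h1
    · exact h1 (hP.trans ((mul_eq_zero.1 hP0).resolve_left hm0.ne'))
    · exact h1 (hQ.trans ((mul_eq_zero.1 hQ0).resolve_left hm0.ne'))
  -- As `r₀ > 0`, the sign `ε` is that of `r₂`.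
  obtain ⟨ε, hε, l, hl, hel⟩ : ∃ ε : ℝ, (ε = 1 ∨ ε = -1) ∧ ∃ l : ℝ, 0 < l ∧
      ε * l ^ 2 * r₂ = r₀ := by
    have habs : 0 < |r₂| := abs_pos.2 hr2ne
    have hsq : Real.sqrt (r₀ / |r₂|) ^ 2 = r₀ / |r₂| := Real.sq_sqrt (by positivity)
    rcases lt_or_gt_of_ne hr2ne with hneg | hpos
    · refine ⟨-1, Or.inr rfl, Real.sqrt (r₀ / |r₂|), Real.sqrt_pos.2 (by positivity), ?_⟩
      rw [hsq, abs_of_neg hneg]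
      field_simp
    · refine ⟨1, Or.inl rfl, Real.sqrt (r₀ / |r₂|), Real.sqrt_pos.2 (by positivity), ?_⟩
      rw [hsq, abs_of_pos hpos]
      field_simp
  have hdetA : l * q₀ * ((q₀ + r₁ * p₀) / r₂) - -(l * p₀) * ((p₀ - r₁ * q₀) / r₂) ≠ 0 := by
    have : l * q₀ * ((q₀ + r₁ * p₀) / r₂) - -(l * p₀) * ((p₀ - r₁ * q₀) / r₂) = l * m₀ / r₂ := by
      rw [hm0']; field_simp; ring
    rw [this]
    exact div_ne_zero (mul_ne_zero hl.ne' hm0.ne') hr2ne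
  have hdetB : 1 * (l * α) - 0 * (l * β) ≠ 0 := by
    rw [one_mul, zero_mul, sub_zero]
    exact mul_ne_zero hl.ne' h
  refine ⟨ε, hε, gl _ _ _ _ hdetA, gl _ _ _ _ hdetB, fun p => ?_⟩
  obtain ⟨x, y, hxy, rfl⟩ := exists_hpt p
  rw [quadMap_hpt _ _ _ _ _ _ hxy, gl_smul_hpt _ (hne x y hxy), gl_smul_hpt _ hxy,
    quadMap_hpt _ _ _ _ _ _ (linear_ne_zero hdetB hxy)]
  congr 1
  · rw [hα, hβ]; ring
  · have e1 := hR x y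
    rw [← hel] at e1
    have e2 : (p₀ - r₁ * q₀) * (p₂ * x ^ 2 + p₁ * x * y + p₀ * y ^ 2)
        + (q₀ + r₁ * p₀) * (q₂ * x ^ 2 + q₁ * x * y + q₀ * y ^ 2)
        = r₂ * (x ^ 2 + ε * (l * (α * y + β * x)) ^ 2) := by
      rw [hm0', hm1, hm2] at e1
      have e3 : q₀ * (p₂ * x ^ 2 + p₁ * x * y + p₀ * y ^ 2)
        - p₀ * (q₂ * x ^ 2 + q₁ * x * y + q₀ * y ^ 2) = x * (α * y + β * x) := by
        rw [hα, hβ]; ring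
      linear_combination e1 - r₁ * e3
    rw [div_mul_eq_mul_div, div_mul_eq_mul_div, ← add_div, e2, mul_div_cancel_left₀ _ hr2ne]
    ring

theorem exists_normal {f : RatFunc ℝ} (hf : ratDegree f = 2) :
    ∃ ε : ℝ, (ε = 1 ∨ ε = -1) ∧ ∃ A B : GL (Fin 2) ℝ, ∀ p,
      A • circleMap f p = quadMap 0 1 0 ε 0 1 (B • p) := by
  have hne := fun x y h => quadForm_ne_zero hf (x := x) (y := y) h
  have hminor := quadForm_minor_ne_zero hf
  rw [circleMap_eq_quadMap hf]
  generalize f.num.coeff 0 = p₀ at *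
  generalize f.num.coeff 1 = p₁ at *
  generalize f.num.coeff 2 = p₂ at *
  generalize f.denom.coeff 0 = q₀ at *
  generalize f.denom.coeff 1 = q₁ at *
  generalize f.denom.coeff 2 = q₂ at *
  obtain ⟨s, hs⟩ : ∃ s : ℝ, (q₂ * s ^ 2 + q₁ * s + q₀) * (2 * p₂ * s + p₁)
      - (p₂ * s ^ 2 + p₁ * s + p₀) * (2 * q₂ * s + q₁) ≠ 0 := by
    -- The Wronskian is a polynomial of degree at most two in `s`. Vanishing at `0`, `1` and `-1`
    -- would kill its coefficients, in particular the two minors.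
    by_contra! hcon
    have h0 := hcon 0
    have h1 := hcon 1
    have h2 := hcon (-1)
    rcases hminor with h | h
    · apply h; linear_combination h0 - (h1 + h2) / 2
    · apply h; linear_combination (h2 - h1) / 4
  have hD : (1 : ℝ) * 1 - s * 0 ≠ 0 := by norm_num
  obtain ⟨ε, hε, A, B, hAB⟩ := quadMap_normal_of_minor (p₀ := p₂ * s ^ 2 + p₁ * s + p₀)
    (p₁ := 2 * p₂ * s + p₁) (p₂ := p₂) (q₀ := q₂ * s ^ 2 + q₁ * s + q₀) (q₁ := 2 * q₂ * s + q₁)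
    (q₂ := q₂) (fun x y hxy => by
      have := hne (1 * x + s * y) (0 * x + 1 * y) (linear_ne_zero hD hxy)
      convert this using 2 <;> ring) hs
  refine ⟨ε, hε, A, B * (gl _ _ _ _ hD)⁻¹, fun p => ?_⟩
  obtain ⟨q, rfl⟩ : ∃ q, gl _ _ _ _ hD • q = p := ⟨(gl _ _ _ _ hD)⁻¹ • p, smul_inv_smul _ _⟩
  rw [mul_smul, inv_smul_smul, ← hAB q]
  congr 1
  obtain ⟨x, y, hxy, rfl⟩ := exists_hpt q
  rw [gl_smul_hpt hD hxy, quadMap_hpt _ _ _ _ _ _ (linear_ne_zero hD hxy),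
    quadMap_hpt _ _ _ _ _ _ hxy]
  congr 1 <;> ring

/-! ### The covering case, of entropy `log 2`. -/

theorem encard_fiber_le_two {X Y : Type*} {T : X → Y} (ι : X → X)
    (h : ∀ x y, T x = T y → y = x ∨ y = ι x) (p : Y) : (T ⁻¹' {p}).encard ≤ 2 := by
  rcases (T ⁻¹' {p}).eq_empty_or_nonempty with he | ⟨x, hx⟩
  · simp [he]
  · refine (encard_le_encard (t := {x, ι x}) ?_).trans ((encard_insert_le _ _).trans (by
      rw [encard_singleton]; norm_num))
    intro y hy
    exact h x y ((hx : T x = p).trans (hy : T y = p).symm)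

/-- The degree two covering `xy / (x² - y²)` of the circle. -/
theorem quadMap_neg_one_hpt {x y : ℝ} (h : x ≠ 0 ∨ y ≠ 0) :
    quadMap 0 1 0 (-1) 0 1 (hpt x y) = hpt (x * y) (x ^ 2 - y ^ 2) := by
  rw [quadMap_hpt _ _ _ _ _ _ h]
  congr 1 <;> ring

theorem mul_ne_zero_or_sq_sub_sq_ne_zero {x y : ℝ} (h : x ≠ 0 ∨ y ≠ 0) :
    x * y ≠ 0 ∨ x ^ 2 - y ^ 2 ≠ 0 := by
  by_contra! hcon
  obtain ⟨h1, h2⟩ := hcon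
  rcases mul_eq_zero.1 h1 with h0 | h0 <;> subst h0
  · simp_all
  · simp_all

/-- Rotation by a right angle, i.e. `x ↦ -1/x`. -/
def quarterTurn : GL (Fin 2) ℝ := gl 0 (-1) 1 0 (by norm_num)

theorem quarterTurn_smul_hpt {x y : ℝ} (h : x ≠ 0 ∨ y ≠ 0) :
    quarterTurn • hpt x y = hpt (-y) x := by
  rw [quarterTurn, gl_smul_hpt _ h]
  congr 1 <;> ring

theorem quarterTurn_smul_ne (p : OnePoint ℝ) : quarterTurn • p ≠ p := by
  obtain ⟨x, y, h, rfl⟩ := exists_hpt p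
  rw [quarterTurn_smul_hpt h, Ne, hpt_eq_iff (by simpa [or_comm] using h) h]
  intro he
  rcases h with h | h
  · have : 0 < x ^ 2 := by positivity
    nlinarith [sq_nonneg y]
  · have : 0 < y ^ 2 := by positivity
    nlinarith [sq_nonneg x]

theorem quadMap_neg_one_quarterTurn (p : OnePoint ℝ) :
    quadMap 0 1 0 (-1) 0 1 (quarterTurn • p) = quadMap 0 1 0 (-1) 0 1 p := by
  obtain ⟨x, y, h, rfl⟩ := exists_hpt p
  have h' : -y ≠ 0 ∨ x ≠ 0 := by simpa [or_comm] using h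
  rw [quarterTurn_smul_hpt h, quadMap_neg_one_hpt h, quadMap_neg_one_hpt h',
    ← hpt_mul (c := -1) (by norm_num)]
  congr 1 <;> ring

theorem eq_or_eq_quarterTurn_of_quadMap_eq (p q : OnePoint ℝ)
    (h : quadMap 0 1 0 (-1) 0 1 p = quadMap 0 1 0 (-1) 0 1 q) : q = p ∨ q = quarterTurn • p := by
  obtain ⟨x, y, hp, rfl⟩ := exists_hpt p
  obtain ⟨x', y', hq, rfl⟩ := exists_hpt q
  rw [quadMap_neg_one_hpt hp, quadMap_neg_one_hpt hq, hpt_eq_iff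
    (mul_ne_zero_or_sq_sub_sq_ne_zero hp) (mul_ne_zero_or_sq_sub_sq_ne_zero hq)] at h
  have : (x' * y - x * y') * (x' * x - (-y) * y') = 0 := by linear_combination h
  rw [quarterTurn_smul_hpt hp, hpt_eq_iff hq hp, hpt_eq_iff hq (by simpa [or_comm] using hp)]
  exact (mul_eq_zero.1 this).imp sub_eq_zero.1 sub_eq_zero.1

theorem quadMap_neg_one_surjective : Function.Surjective (quadMap 0 1 0 (-1) 0 1) := by
  intro p
  obtain ⟨u, v, h, rfl⟩ := exists_hpt p
  by_cases hu : u = 0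
  · subst hu
    refine ⟨hpt 0 1, ?_⟩
    rw [quadMap_neg_one_hpt (by simp), hpt_eq_iff (by simp) h]
    simp
  · have hs : Real.sqrt (v ^ 2 + 4 * u ^ 2) ^ 2 = v ^ 2 + 4 * u ^ 2 := Real.sq_sqrt (by positivity)
    set s := Real.sqrt (v ^ 2 + 4 * u ^ 2)
    refine ⟨hpt ((v + s) / (2 * u)) 1, ?_⟩
    rw [quadMap_neg_one_hpt (by simp), hpt_eq_iff (mul_ne_zero_or_sq_sub_sq_ne_zero (by simp)) h]
    field_simp
    linear_combination -hs

/-- On the slope `x/y = tan θ` the covering is `-½ tan 2θ`, an angle doubling. The two preimages of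
a point differ by the quarter turn, which has no fixed point, so they are uniformly separated. -/
theorem topEntropy_covering (M : GL (Fin 2) ℝ) :
    topEntropy (fun p => M • quadMap 0 1 0 (-1) 0 1 p) = ((Real.log 2 : ℝ) : EReal) := by
  set T : OnePoint ℝ → OnePoint ℝ := fun p => M • quadMap 0 1 0 (-1) 0 1 p with hTdef
  have hT : Continuous T := (continuous_gl_smul M).comp <| continuous_of_hpt
    (P := fun x y => x * y) (Q := fun x y => x ^ 2 - y ^ 2) (by fun_prop) (by fun_prop)
    (fun x y h => mul_ne_zero_or_sq_sub_sq_ne_zero h) fun x y h => quadMap_neg_one_hpt h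
  have hsurj : Function.Surjective T :=
    (MulAction.surjective M).comp quadMap_neg_one_surjective
  refine le_antisymm (topEntropy_le_log_two hT (encard_fiber_le_two (fun p => quarterTurn • p)
    fun x y h => eq_or_eq_quarterTurn_of_quadMap_eq x y (MulAction.injective M h))) ?_
  let g₀ := Function.surjInv hsurj
  have hg₀ : ∀ p, T (g₀ p) = p := Function.surjInv_eq hsurj
  refine log_two_le_topEntropy (z := OnePoint.infty) (g₀ := g₀) (g₁ := fun p => quarterTurn • g₀ p)
    ?_ ?_
  · intro S j
    rw [wordPoint]
    split_ifs
    · rw [hTdef]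
      simp only [quadMap_neg_one_quarterTurn]
      exact hg₀ _
    · exact hg₀ _
  · intro k _
    -- Since the two branches never meet, one entourage serves for every `k`.
    refine ⟨{q | q.2 ≠ quarterTurn • q.1 ∧ q.1 ≠ quarterTurn • q.2}, ?_, ?_, ?_⟩
    · exact (isOpen_ne_fun continuous_snd ((continuous_gl_smul _).comp continuous_fst)).inter
        (isOpen_ne_fun continuous_fst ((continuous_gl_smul _).comp continuous_snd))
    · exact fun x => ⟨(quarterTurn_smul_ne x).symm, (quarterTurn_smul_ne x).symm⟩
    · intro S _ j
      exact ⟨fun h => h.1 rfl, fun h => h.2 rfl⟩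

/-! ### Fold maps. -/

/-- The map `2uv / (u² + v²)` of the circle, where `u : v` is the image of a point under the
matrix with rows `(a, b)` and `(c, d)`. -/
def foldMap (a b c d : ℝ) : OnePoint ℝ → OnePoint ℝ :=
  quadMap (2 * b * d) (2 * (a * d + b * c)) (2 * a * c) (b ^ 2 + d ^ 2) (2 * (a * b + c * d))
    (a ^ 2 + c ^ 2)

theorem foldMap_hpt (a b c d : ℝ) {x y : ℝ} (h : x ≠ 0 ∨ y ≠ 0) : foldMap a b c d (hpt x y) =
    hpt (2 * (a * x + b * y) * (c * x + d * y)) ((a * x + b * y) ^ 2 + (c * x + d * y) ^ 2) := by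
  rw [foldMap, quadMap_hpt _ _ _ _ _ _ h]
  congr 1 <;> ring

theorem sq_add_sq_pos {u v : ℝ} (h : u ≠ 0 ∨ v ≠ 0) : 0 < u ^ 2 + v ^ 2 := by
  rcases h with h | h
  · have : 0 < u ^ 2 := by positivity
    positivity
  · have : 0 < v ^ 2 := by positivity
    positivity

theorem fold_denom_pos {a b c d : ℝ} (hdet : a * d - b * c ≠ 0) {x y : ℝ} (h : x ≠ 0 ∨ y ≠ 0) :
    0 < (a * x + b * y) ^ 2 + (c * x + d * y) ^ 2 :=
  sq_add_sq_pos (linear_ne_zero hdet h)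

/-- The real function underlying `foldMap`. -/
def foldFun (a b c d x : ℝ) : ℝ :=
  2 * (a * x + b) * (c * x + d) / ((a * x + b) ^ 2 + (c * x + d) ^ 2)

theorem foldFun_denom_pos {a b c d : ℝ} (hdet : a * d - b * c ≠ 0) (x : ℝ) :
    0 < (a * x + b) ^ 2 + (c * x + d) ^ 2 := by
  simpa using fold_denom_pos hdet (x := x) (y := 1) (by simp)

theorem foldMap_coe {a b c d : ℝ} (hdet : a * d - b * c ≠ 0) (x : ℝ) :
    foldMap a b c d (x : OnePoint ℝ) = (foldFun a b c d x : OnePoint ℝ) := by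
  rw [← hpt_one, foldMap_hpt _ _ _ _ (by simp), mul_one, mul_one,
    hpt_of_ne (foldFun_denom_pos hdet x).ne']
  rfl

theorem continuous_foldMap {a b c d : ℝ} (hdet : a * d - b * c ≠ 0) :
    Continuous (foldMap a b c d) :=
  continuous_of_hpt (P := fun x y => 2 * (a * x + b * y) * (c * x + d * y))
    (Q := fun x y => (a * x + b * y) ^ 2 + (c * x + d * y) ^ 2) (by fun_prop) (by fun_prop)
    (fun _ _ h => Or.inr (fold_denom_pos hdet h).ne') fun _ _ h => foldMap_hpt _ _ _ _ h

theorem abs_two_mul_div_le_one (u v : ℝ) : |2 * u * v / (u ^ 2 + v ^ 2)| ≤ 1 := by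
  have h0 : 0 ≤ u ^ 2 + v ^ 2 := by positivity
  rw [abs_div, abs_of_nonneg h0]
  refine div_le_one_of_le₀ ?_ h0
  rw [abs_le]
  constructor <;> nlinarith [sq_nonneg (u + v), sq_nonneg (u - v)]

theorem foldFun_mem_Icc (a b c d x : ℝ) : foldFun a b c d x ∈ Icc (-1 : ℝ) 1 :=
  abs_le.1 (abs_two_mul_div_le_one _ _)

theorem foldMap_mem {a b c d : ℝ} (hdet : a * d - b * c ≠ 0) (p : OnePoint ℝ) :
    foldMap a b c d p ∈ ((↑) : ℝ → OnePoint ℝ) '' Icc (-1) 1 := by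
  obtain ⟨x, y, h, rfl⟩ := exists_hpt p
  rw [foldMap_hpt _ _ _ _ h, hpt_of_ne (fold_denom_pos hdet h).ne']
  exact ⟨_, abs_le.1 (abs_two_mul_div_le_one _ _), rfl⟩

/-- This is the source of all monotonicity statements. On the diagonal the last factor becomes `v² -
u²`, so it also gives the sign of the derivative. -/
theorem foldFun_sub {a b c d : ℝ} (hdet : a * d - b * c ≠ 0) (x y : ℝ) :
    foldFun a b c d x - foldFun a b c d y =
      2 * (a * d - b * c) * (x - y) * ((c * x + d) * (c * y + d) - (a * x + b) * (a * y + b)) /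
      (((a * x + b) ^ 2 + (c * x + d) ^ 2) * ((a * y + b) ^ 2 + (c * y + d) ^ 2)) := by
  rw [foldFun, foldFun, div_sub_div _ _ (foldFun_denom_pos hdet x).ne' (foldFun_denom_pos hdet y).ne']
  congr 1
  ring

/-- The value is unchanged when `u` and `v` are exchanged, and this involution accounts for the
whole fibre. -/
theorem foldMap_fiber {a b c d : ℝ} (hdet : a * d - b * c ≠ 0) (p : OnePoint ℝ) :
    (foldMap a b c d ⁻¹' {p}).encard ≤ 2 := by
  have hsw : (0 : ℝ) * 0 - 1 * 1 ≠ 0 := by norm_num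
  refine encard_fiber_le_two
    (fun p => (gl a b c d hdet)⁻¹ • gl 0 1 1 0 hsw • gl a b c d hdet • p) ?_ p
  intro p q h
  obtain ⟨x, y, hp, rfl⟩ := exists_hpt p
  obtain ⟨x', y', hq, rfl⟩ := exists_hpt q
  rw [foldMap_hpt _ _ _ _ hp, foldMap_hpt _ _ _ _ hq, hpt_eq_iff
    (Or.inr (fold_denom_pos hdet hp).ne') (Or.inr (fold_denom_pos hdet hq).ne')] at h
  have hp' := linear_ne_zero hdet hp
  have hq' := linear_ne_zero hdet hq
  rw [eq_inv_smul_iff, gl_smul_hpt _ hp, gl_smul_hpt _ hq, gl_smul_hpt _ hp']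
  rw [← (MulAction.injective (gl a b c d hdet)).eq_iff (a := hpt x' y'), gl_smul_hpt _ hp,
    gl_smul_hpt _ hq]
  rw [hpt_eq_iff hq' hp', hpt_eq_iff hq' (by simpa [or_comm] using hp')]
  generalize a * x + b * y = u at *
  generalize c * x + d * y = v at *
  generalize a * x' + b * y' = u' at *
  generalize c * x' + d * y' = v' at *
  have : (u' * v - u * v') * (u' * (1 * u + 0 * v) - (0 * u + 1 * v) * v') = 0 := by
    linear_combination h / 2
  exact (mul_eq_zero.1 this).imp sub_eq_zero.1 sub_eq_zero.1

theorem topEntropy_foldMap_le {a b c d : ℝ} (hdet : a * d - b * c ≠ 0) :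
    topEntropy (foldMap a b c d) ≤ ((Real.log 2 : ℝ) : EReal) :=
  topEntropy_le_log_two (continuous_foldMap hdet) (foldMap_fiber hdet)

/-- A real quadratic rational map is conjugate to a fold map, or it is a covering of the circle. -/
theorem mobiusConj_foldMap_or_entropy {f : RatFunc ℝ} (hf : ratDegree f = 2) :
    (∃ a b c d : ℝ, a * d - b * c ≠ 0 ∧ MobiusConj (circleMap f) (foldMap a b c d)) ∨
    realEntropy f = ((Real.log 2 : ℝ) : EReal) := by
  obtain ⟨ε, rfl | rfl, A, B, hAB⟩ := exists_normal hf
  · left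
    -- The factor `diag(2, 1)` turns `uv/(u² + v²)` into `2uv/(u² + v²)`, with critical values `±1`.
    have hD : (2 : ℝ) * 1 - 0 * 0 ≠ 0 := by norm_num
    obtain ⟨a, b, c, d, h, hN⟩ := exists_gl (B * (gl 2 0 0 1 hD * A)⁻¹)
    refine ⟨a, b, c, d, h, gl 2 0 0 1 hD * A, fun p => ?_⟩
    rw [mul_smul, hAB]
    have hB : B • p = gl a b c d h • (gl 2 0 0 1 hD * A) • p := by
      rw [← hN, mul_smul, inv_smul_smul]
    rw [hB]
    generalize (gl 2 0 0 1 hD * A) • p = q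
    obtain ⟨x, y, hq, rfl⟩ := exists_hpt q
    have hq' := linear_ne_zero h hq
    have hpos := fold_denom_pos h hq
    rw [gl_smul_hpt _ hq, quadMap_hpt _ _ _ _ _ _ hq', gl_smul_hpt, foldMap_hpt _ _ _ _ hq]
    · congr 1 <;> ring
    · right
      have : 1 * (a * x + b * y) ^ 2 + 0 * (a * x + b * y) * (c * x + d * y) + 1 * (c * x + d * y) ^ 2
        = (a * x + b * y) ^ 2 + (c * x + d * y) ^ 2 := by ring
      rw [this]
      exact hpos.ne'
  · right
    rw [← topEntropy_covering (B * A⁻¹)]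
    refine MobiusConj.topEntropy_eq ⟨B, fun p => ?_⟩
    change B • circleMap f p = (B * A⁻¹) • quadMap 0 1 0 (-1) 0 1 (B • p)
    rw [← hAB, mul_smul, inv_smul_smul]

theorem normalFun_eq_foldFun (μ t x : ℝ) : normalFun μ t x = foldFun μ 0 t 2 x := by
  rw [normalFun, foldFun]
  congr 1 <;> ring

/-- The finite points are already settled. At `∞` the leading coefficients in lowest terms are
needed, which is why `P` and `Q` are shown to be coprime. -/
theorem circleMap_normalForm {μ : ℝ} (hμ : μ ≠ 0) (t : ℝ) :
    circleMap (normalForm μ t) = foldMap μ 0 t 2 := by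
  have hdet : μ * 2 - 0 * t ≠ 0 := by simpa using hμ
  funext p
  induction p with
  | coe x => rw [circleMap_normalForm_coe hμ, foldMap_coe hdet, normalFun_eq_foldFun]
  | infty =>
    set P : ℝ[X] := C (2 * μ) * X * (C t * X + C 2) with hP
    set Q : ℝ[X] := C (μ ^ 2) * X ^ 2 + (C t * X + C 2) ^ 2 with hQ
    have hP' : P = C (2 * μ * t) * X ^ 2 + C (4 * μ) * X := by
      rw [hP]
      simp only [C_mul]
      have : (C 4 : ℝ[X]) = C 2 * C 2 := by rw [← C_mul]; norm_num
      rw [this]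
      ring
    have hQ' : Q = C (μ ^ 2 + t ^ 2) * X ^ 2 + C (4 * t) * X + C 4 := by
      rw [hQ]
      have : (C 4 : ℝ[X]) = C 2 * C 2 := by rw [← C_mul]; norm_num
      simp only [C_mul, C_add, C_pow, this]
      have h2 : (C 2 : ℝ[X]) = 2 := rfl
      rw [h2]
      ring
    have hpos : 0 < μ ^ 2 + t ^ 2 := by positivity
    have hcop : IsCoprime P Q := by
      have hu : IsCoprime (C μ * X) (C t * X + C 2) := by
        refine ⟨C (-t / (2 * μ)), C (1 / 2), ?_⟩
        have e1 : C (-t / (2 * μ)) * (C μ * X) = C (-t / 2) * X := by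
          rw [← mul_assoc, ← C_mul]; congr 2; field_simp
        have e2 : C (1 / 2 : ℝ) * (C t * X + C 2) = C (t / 2) * X + 1 := by
          rw [mul_add, ← mul_assoc, ← C_mul, ← C_mul]
          congr 3
          · ring
          · norm_num
        rw [e1, e2, ← add_assoc, ← add_mul, ← C_add]
        rw [show -t / 2 + t / 2 = 0 by ring, C_0, zero_mul, zero_add]
      have h1 : IsCoprime (C μ * X) Q := by
        have : Q = (C t * X + C 2) ^ 2 + (C μ * X) * (C μ * X) := by
          rw [hQ, C_pow]; ring
        rw [this]
        exact (hu.pow_right).add_mul_left_right _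
      have h2 : IsCoprime (C t * X + C 2) Q := by
        have : Q = (C μ * X) ^ 2 + (C t * X + C 2) * (C t * X + C 2) := by
          rw [hQ, C_pow]; ring
        rw [this]
        exact (hu.symm.pow_right).add_mul_left_right _
      have h3 : P = C 2 * ((C μ * X) * (C t * X + C 2)) := by
        rw [hP, C_mul]; ring
      rw [h3]
      exact (isCoprime_mul_unit_left_left (isUnit_C.2 (by norm_num)) _ _).2 (h1.mul_left h2)
    have hQdeg : Q.natDegree = 2 := by
      rw [hQ']
      exact natDegree_quadratic hpos.ne'
    have hQ0 : Q ≠ 0 := by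
      rintro h
      simp [h] at hQdeg
    have hkey : (normalForm μ t).num * Q = P * (normalForm μ t).denom :=
      (RatFunc.num_mul_eq_mul_denom_iff hQ0).2 rfl
    have hd1 : (normalForm μ t).denom ∣ Q := RatFunc.denom_div_dvd P Q
    have hd2 : Q ∣ (normalForm μ t).denom :=
      hcop.symm.dvd_of_dvd_mul_left ⟨_, by rw [← hkey, mul_comm]⟩
    obtain ⟨w, hw⟩ := associated_of_dvd_dvd hd1 hd2
    obtain ⟨k, hk, hkw⟩ := isUnit_iff.1 w.isUnit
    rw [← hkw] at hw
    have hk0 : k ≠ 0 := hk.ne_zero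
    have hd0 := (normalForm μ t).denom_ne_zero
    have hnum : (normalForm μ t).num * C k = P := by
      refine mul_right_cancel₀ hd0 ?_
      rw [← hkey, ← hw]; ring
    have hdd : (normalForm μ t).denom.natDegree = 2 := by
      rw [← hQdeg, ← hw, natDegree_mul_C hk0]
    have hnd : (normalForm μ t).num.natDegree ≤ 2 := by
      rw [← natDegree_mul_C hk0, hnum, hP']
      compute_degree
    have hdeg : ratDegree (normalForm μ t) = 2 := by
      rw [ratDegree, hdd, max_eq_right hnd]
    have c1 : (normalForm μ t).num.coeff 2 * k = 2 * μ * t := by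
      rw [← coeff_mul_C, hnum, hP', coeff_add, coeff_C_mul, coeff_C_mul, coeff_X_pow, coeff_X]
      norm_num
    have c2 : (normalForm μ t).denom.coeff 2 * k = μ ^ 2 + t ^ 2 := by
      rw [← coeff_mul_C, hw, hQ', coeff_add, coeff_add, coeff_C_mul, coeff_C_mul, coeff_X_pow,
        coeff_X, coeff_C]
      norm_num
    rw [circleMap_eq_quadMap hdeg, ← hpt_zero 1, quadMap_hpt _ _ _ _ _ _ (by simp),
      foldMap_hpt _ _ _ _ (by simp), ← hpt_mul hk0]
    congr 1
    · linear_combination c1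
    · linear_combination c2

theorem foldMap_smul {k : ℝ} (hk : k ≠ 0) (a b c d : ℝ) :
    foldMap (k * a) (k * b) (k * c) (k * d) = foldMap a b c d := by
  funext p
  obtain ⟨x, y, h, rfl⟩ := exists_hpt p
  rw [foldMap_hpt _ _ _ _ h, foldMap_hpt _ _ _ _ h,
    ← hpt_mul (pow_ne_zero 2 hk) (2 * (a * x + b * y) * (c * x + d * y))]
  congr 1 <;> ring

theorem foldMap_swap (a b c d : ℝ) : foldMap a b c d = foldMap c d a b := by
  funext p
  obtain ⟨x, y, h, rfl⟩ := exists_hpt p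
  rw [foldMap_hpt _ _ _ _ h, foldMap_hpt _ _ _ _ h]
  congr 1 <;> ring

/-! ### Moving a fixed point to the origin. -/

/-- Moving a fixed point `p = 2q / (1 + q²)` of a fold map to the origin by a Möbius transformation
preserving the points `1` and `-1`. -/
theorem mobiusConj_normal_of_fixed {a b c d p q : ℝ} (hdet : a * d - b * c ≠ 0)
    (hp : p * (1 + q ^ 2) = 2 * q) (hq : a * p + b = q * (c * p + d)) (hq1 : q ^ 2 ≠ 1) :
    ∃ μ t : ℝ, MobiusConj (foldMap a b c d) (foldMap μ 0 t 2) ∧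
      0 < μ * ((1 - q ^ 2) * (a * d - b * c)) := by
  have hq1' : 1 - q ^ 2 ≠ 0 := sub_ne_zero.2 hq1.symm
  have hq2 : 0 < 1 + q ^ 2 := by positivity
  have hpq : (1 - p ^ 2) * (1 + q ^ 2) ^ 2 = (1 - q ^ 2) ^ 2 := by
    linear_combination -(p * (1 + q ^ 2) + 2 * q) * hp
  have hp1 : 0 < 1 - p ^ 2 := by
    have : 0 < (1 - q ^ 2) ^ 2 := by positivity
    rw [← hpq] at this
    exact pos_of_mul_pos_left this (by positivity)
  have hm : c * p + d ≠ 0 := by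
    intro h
    rw [h, mul_zero] at hq
    rcases linear_ne_zero hdet (x := p) (y := 1) (by simp) with h' | h'
    · exact h' (by rw [mul_one]; exact hq)
    · exact h' (by rw [mul_one]; exact h)
  set m := c * p + d with hmdef
  -- The new forms are `u - qv` and `v - qu`, written in the coordinates `x - py`, `y - px` up to
  -- the factor `1 - p²`. This is the addition formula for `tanh`: if `u/v = tanh s`, the map is
  -- `tanh 2s`, and subtracting `artanh q` from `s` moves the value by the Möbius map sending `p =
  -- 2q/(1 + q²)` to `0`. The entry `b'` is `0` by `hq`.
  set a' := a + b * p - q * (c + d * p) with ha'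
  set c' := c + d * p - q * (a + b * p) with hc'
  set d' := m * (1 - q ^ 2) with hd'
  have hd'0 : d' ≠ 0 := mul_ne_zero hm hq1'
  have hprod : a' * d' = (1 - q ^ 2) * (a * d - b * c) * (1 - p ^ 2) := by
    rw [ha', hd', hmdef]
    linear_combination (1 - q ^ 2) * (c + d * p) * hq
  refine ⟨2 / d' * a', 2 / d' * c', ?_, ?_⟩
  · have hfold := foldMap_smul (div_ne_zero two_ne_zero hd'0) a' 0 c' d'
    rw [mul_zero, div_mul_cancel₀ 2 hd'0] at hfold
    rw [hfold]
    have hg : 1 * 1 - -p * -p ≠ 0 := by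
      have : 1 * 1 - -p * -p = 1 - p ^ 2 := by ring
      rw [this]; exact hp1.ne'
    refine ⟨gl 1 (-p) (-p) 1 hg, fun z => ?_⟩
    obtain ⟨x, y, h, rfl⟩ := exists_hpt z
    have hpos := fold_denom_pos hdet h
    rw [gl_smul_hpt hg h, foldMap_hpt _ _ _ _ h, gl_smul_hpt hg (Or.inr hpos.ne'),
      foldMap_hpt _ _ _ _ (linear_ne_zero hg h)]
    have e1 : a' * (1 * x + -p * y) + 0 * (-p * x + 1 * y)
        = (1 - p ^ 2) * ((a * x + b * y) - q * (c * x + d * y)) := by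
      rw [ha']
      linear_combination (p * x - y) * hq
    have e2 : c' * (1 * x + -p * y) + d' * (-p * x + 1 * y)
        = (1 - p ^ 2) * ((c * x + d * y) - q * (a * x + b * y)) := by
      rw [hc', hd', hmdef]
      linear_combination (q * (-p * x + y)) * hq
    rw [e1, e2]
    generalize a * x + b * y = u at *
    generalize c * x + d * y = v at *
    rw [← hpt_mul hq2.ne']
    have e3 : 2 * ((1 - p ^ 2) * (u - q * v)) * ((1 - p ^ 2) * (v - q * u))
        = (1 - p ^ 2) ^ 2 * (2 * (u - q * v) * (v - q * u)) := by ring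
    have e4 : ((1 - p ^ 2) * (u - q * v)) ^ 2 + ((1 - p ^ 2) * (v - q * u)) ^ 2
        = (1 - p ^ 2) ^ 2 * ((u - q * v) ^ 2 + (v - q * u) ^ 2) := by ring
    rw [e3, e4, hpt_mul (pow_ne_zero 2 hp1.ne')]
    congr 1
    · linear_combination -(u ^ 2 + v ^ 2) * hp
    · linear_combination -2 * u * v * hp
  · have : 2 / d' * a' * ((1 - q ^ 2) * (a * d - b * c))
        = 2 * (1 - p ^ 2) * ((1 - q ^ 2) * (a * d - b * c) / d') ^ 2 := by
      field_simp
      linear_combination hprod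
    rw [this]
    have : (1 - q ^ 2) * (a * d - b * c) / d' ≠ 0 :=
      div_ne_zero (mul_ne_zero hq1' hdet) hd'0
    positivity

/-- Together with `foldFun_add_one` this locates the critical points: the value `1` is attained only
where `v = u`, the value `-1` only where `v = -u`. -/
theorem one_sub_foldFun {a b c d : ℝ} (hdet : a * d - b * c ≠ 0) (x : ℝ) :
    1 - foldFun a b c d x =
      ((c - a) * x + (d - b)) ^ 2 / ((a * x + b) ^ 2 + (c * x + d) ^ 2) := by
  rw [foldFun, eq_div_iff (foldFun_denom_pos hdet x).ne', sub_mul,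
    div_mul_cancel₀ _ (foldFun_denom_pos hdet x).ne']
  ring

theorem foldFun_add_one {a b c d : ℝ} (hdet : a * d - b * c ≠ 0) (x : ℝ) :
    foldFun a b c d x + 1 =
      ((c + a) * x + (d + b)) ^ 2 / ((a * x + b) ^ 2 + (c * x + d) ^ 2) := by
  rw [foldFun, eq_div_iff (foldFun_denom_pos hdet x).ne', add_mul,
    div_mul_cancel₀ _ (foldFun_denom_pos hdet x).ne']
  ring

theorem exists_mobiusConj_normal_of_fixed {a b c d p : ℝ} (hdet : a * d - b * c ≠ 0)
    (hp : p ∈ Ioo (-1 : ℝ) 1) (hfix : foldFun a b c d p = p) :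
    ∃ μ t : ℝ, μ ≠ 0 ∧ MobiusConj (foldMap a b c d) (foldMap μ 0 t 2) := by
  have hpos := foldFun_denom_pos hdet p
  have hα := one_sub_foldFun hdet p
  have hβ := foldFun_add_one hdet p
  rw [hfix, eq_div_iff hpos.ne'] at hα hβ
  have hα0 : (c - a) * p + (d - b) ≠ 0 := by
    intro h
    rw [h] at hα
    have := mul_pos (sub_pos.2 hp.2) hpos
    simp only [ne_eq, OfNat.ofNat_ne_zero, not_false_eq_true, zero_pow] at hα
    exact this.ne' hα
  have hβ0 : (c + a) * p + (d + b) ≠ 0 := by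
    intro h
    rw [h] at hβ
    have := mul_pos (show 0 < p + 1 by linarith [hp.1]) hpos
    simp only [ne_eq, OfNat.ofNat_ne_zero, not_false_eq_true, zero_pow] at hβ
    exact this.ne' hβ
  have hfix' : p * ((a * p + b) ^ 2 + (c * p + d) ^ 2) = 2 * (a * p + b) * (c * p + d) := by
    linear_combination (hβ - hα) / 2
  -- The ratio `q = u/v` is undefined when `v` vanishes at `p`; then `p = 0`, and exchanging `u` and
  -- `v` gives `q = 0`.
  by_cases hm : c * p + d = 0
  · have hn : a * p + b ≠ 0 := by
      intro h
      rw [h, hm] at hpos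
      simp at hpos
    have hp0 : p = 0 := by
      rw [hm] at hfix'
      simpa [hn] using hfix'
    have hdet' : c * b - d * a ≠ 0 := fun h => hdet (by linear_combination -h)
    obtain ⟨μ, t, hc, hpos⟩ := mobiusConj_normal_of_fixed (p := p) (q := 0) hdet'
      (by rw [hp0]; ring) (by rw [hm]; ring) (by norm_num)
    refine ⟨μ, t, ?_, ?_⟩
    · rintro rfl
      simp at hpos
    · rw [foldMap_swap]; exact hc
  · have hq2 : (c * p + d) ^ 2 ≠ 0 := pow_ne_zero 2 hm
    obtain ⟨μ, t, hc, hpos⟩ := mobiusConj_normal_of_fixed (p := p) (q := (a * p + b) / (c * p + d))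
      hdet (by
        generalize a * p + b = n at *
        generalize c * p + d = m at *
        field_simp
        linear_combination hfix') (div_mul_cancel₀ _ hm).symm (by
        rw [div_pow, Ne, div_eq_one_iff_eq hq2]
        intro h
        have : ((c - a) * p + (d - b)) * ((c + a) * p + (d + b)) = 0 := by linear_combination -h
        exact mul_ne_zero hα0 hβ0 this)
    refine ⟨μ, t, ?_, hc⟩
    rintro rfl
    simp at hpos

/-! ### Critical points, fixed points and monotone fold maps. -/

theorem continuous_foldFun {a b c d : ℝ} (hdet : a * d - b * c ≠ 0) :
    Continuous (foldFun a b c d) := by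
  unfold foldFun
  exact Continuous.div (by fun_prop) (by fun_prop) fun x => (foldFun_denom_pos hdet x).ne'

/-- A fold map with a critical point inside `(-1, 1)` has a fixed point there. -/
theorem exists_fixed_of_critical {a b c d : ℝ} (hdet : a * d - b * c ≠ 0)
    (h : ((c - a) * -1 + (d - b)) * ((c - a) * 1 + (d - b)) < 0 ∨
      ((c + a) * -1 + (d + b)) * ((c + a) * 1 + (d + b)) < 0) :
    ∃ p ∈ Ioo (-1 : ℝ) 1, foldFun a b c d p = p := by
  have hzero : ∀ r s : ℝ, (r * -1 + s) * (r * 1 + s) < 0 → ∃ x ∈ Ioo (-1 : ℝ) 1, r * x + s = 0 := by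
    intro r s hrs
    have hr2 : s ^ 2 < r ^ 2 := by linarith [show (r * -1 + s) * (r * 1 + s) = s ^ 2 - r ^ 2 by ring]
    have hr : r ≠ 0 := by
      rintro rfl
      nlinarith [sq_nonneg s]
    refine ⟨-s / r, ?_, by field_simp; ring⟩
    have h1 : (-s / r) ^ 2 < 1 := by
      rw [div_pow, neg_sq, div_lt_one (by positivity)]
      exact hr2
    exact abs_lt.1 ((sq_lt_one_iff_abs_lt_one _).1 h1)
  have hcont : Continuous fun x => foldFun a b c d x - x :=
    (continuous_foldFun hdet).sub continuous_id
  -- At the critical point with value `1` the graph lies above the diagonal, and at `1` below it, as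
  -- `1` is not critical. The value `-1` is treated symmetrically.
  rcases h with h | h
  · obtain ⟨x, hx, hx0⟩ := hzero _ _ h
    have h1 : 1 - foldFun a b c d x = 0 := by
      rw [one_sub_foldFun hdet, hx0]; simp
    have h2 : 0 < 1 - foldFun a b c d 1 := by
      rw [one_sub_foldFun hdet]
      have : (c - a) * 1 + (d - b) ≠ 0 := fun h0 => by rw [h0, mul_zero] at h; exact h.false
      have := foldFun_denom_pos hdet 1
      positivity
    obtain ⟨p, hp, hpf⟩ := intermediate_value_Ioo' hx.2.le hcont.continuousOn
      (show (0 : ℝ) ∈ Ioo (foldFun a b c d 1 - 1) (foldFun a b c d x - x) from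
        ⟨by linarith, by linarith [hx.2]⟩)
    exact ⟨p, ⟨hx.1.trans hp.1, hp.2⟩, sub_eq_zero.1 hpf⟩
  · obtain ⟨x, hx, hx0⟩ := hzero _ _ h
    have h1 : foldFun a b c d x + 1 = 0 := by
      rw [foldFun_add_one hdet, hx0]; simp
    have h2 : 0 < foldFun a b c d (-1) + 1 := by
      rw [foldFun_add_one hdet]
      have : (c + a) * -1 + (d + b) ≠ 0 := fun h0 => by rw [h0, zero_mul] at h; exact h.false
      have := foldFun_denom_pos hdet (-1)
      positivity
    obtain ⟨p, hp, hpf⟩ := intermediate_value_Ioo' hx.1.le hcont.continuousOn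
      (show (0 : ℝ) ∈ Ioo (foldFun a b c d x - x) (foldFun a b c d (-1) - -1) from
        ⟨by linarith [hx.1], by linarith⟩)
    exact ⟨p, ⟨hp.1, hp.2.trans hx.2⟩, sub_eq_zero.1 hpf⟩

/-- A fold map takes different values at points which are not separated by a critical point. -/
theorem foldFun_ne {a b c d : ℝ} (hdet : a * d - b * c ≠ 0) {x y : ℝ} (hxy : x ≠ y)
    (hα : 0 ≤ ((c - a) * x + (d - b)) * ((c - a) * y + (d - b)))
    (hβ : 0 ≤ ((c + a) * x + (d + b)) * ((c + a) * y + (d + b))) :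
    foldFun a b c d x ≠ foldFun a b c d y := by
  intro h
  have h1 := foldFun_sub hdet x y
  rw [h, sub_self, eq_comm, div_eq_zero_iff] at h1
  have h2 : (c * x + d) * (c * y + d) - (a * x + b) * (a * y + b) = 0 := by
    rcases h1 with h1 | h1
    · rcases mul_eq_zero.1 h1 with h1 | h1
      · exact absurd h1 (mul_ne_zero (mul_ne_zero two_ne_zero hdet) (sub_ne_zero.2 hxy))
      · exact h1
    · exact absurd h1 (mul_pos (foldFun_denom_pos hdet x) (foldFun_denom_pos hdet y)).ne'
  have hx := (foldFun_denom_pos hdet x)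
  have hy := (foldFun_denom_pos hdet y)
  have haff : ∀ r s : ℝ, r * x + s = 0 → r * y + s = 0 → r = 0 ∧ s = 0 := by
    intro r s e1 e2
    have : r * (x - y) = 0 := by linear_combination e1 - e2
    have hr : r = 0 := (mul_eq_zero.1 this).resolve_right (sub_ne_zero.2 hxy)
    subst hr
    exact ⟨rfl, by linarith⟩
  -- Write `α = v - u` and `β = v + u`. Equal values force `α(x)β(y) + β(x)α(y) = 0`; the product of
  -- the two terms is nonnegative by `hα` and `hβ`, so both vanish.
  have hA : ((c - a) * x + (d - b)) * ((c + a) * y + (d + b)) = 0 := by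
    have e1 : ((c - a) * x + (d - b)) * ((c + a) * y + (d + b))
        + ((c + a) * x + (d + b)) * ((c - a) * y + (d - b)) = 0 := by linear_combination 2 * h2
    nlinarith [mul_nonneg hα hβ,
      sq_nonneg (((c - a) * x + (d - b)) * ((c + a) * y + (d + b)))]
  have hB : ((c + a) * x + (d + b)) * ((c - a) * y + (d - b)) = 0 := by
    linear_combination 2 * h2 - hA
  have hαβ : ∀ z, ¬ ((c - a) * z + (d - b) = 0 ∧ (c + a) * z + (d + b) = 0) := by
    rintro z ⟨e1, e2⟩
    have e3 : a * z + b = 0 := by linarith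
    have e4 : c * z + d = 0 := by linarith
    have := foldFun_denom_pos hdet z
    rw [e3, e4] at this
    simp at this
  rcases mul_eq_zero.1 hA with e | e
  · have e' := (mul_eq_zero.1 hB).resolve_left fun e' => hαβ x ⟨e, e'⟩
    obtain ⟨r, s⟩ := haff _ _ e e'
    exact hdet (by linear_combination -d * r + c * s)
  · have e' := (mul_eq_zero.1 hB).resolve_right fun e' => hαβ y ⟨e', e⟩
    obtain ⟨r, s⟩ := haff _ _ e' e
    exact hdet (by linear_combination d * r - c * s)

theorem injOn_foldMap {a b c d : ℝ} (hdet : a * d - b * c ≠ 0) {K : Set ℝ}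
    (h : InjOn (foldFun a b c d) K) : InjOn (foldMap a b c d) ((↑) '' K) := by
  rintro _ ⟨x, hx, rfl⟩ _ ⟨y, hy, rfl⟩ he
  rw [foldMap_coe hdet, foldMap_coe hdet, OnePoint.coe_eq_coe] at he
  rw [h hx hy he]

/-- The entropy of a fold map vanishes if the interval `[-1, 1]` decomposes into an invariant set
and a complementary set, such that the map is injective on both of them. -/
theorem topEntropy_foldMap_eq_zero {a b c d : ℝ} (hdet : a * d - b * c ≠ 0) {K : Set ℝ}
    (hK : MapsTo (foldFun a b c d) K K) (h1 : InjOn (foldFun a b c d) K)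
    (h2 : InjOn (foldFun a b c d) (Icc (-1) 1 \ K)) : topEntropy (foldMap a b c d) = 0 := by
  refine topEntropy_eq_zero_of_injOn (continuous_foldMap hdet) (foldMap_fiber hdet)
    (I := (↑) '' Icc (-1 : ℝ) 1) (K := (↑) '' K) (foldMap_mem hdet) ?_ (injOn_foldMap hdet h1) ?_
  · rintro _ ⟨x, hx, rfl⟩
    rw [foldMap_coe hdet]
    exact ⟨_, hK hx, rfl⟩
  · rw [← image_sdiff OnePoint.coe_injective]
    exact injOn_foldMap hdet h2

/-- A fold map without critical points inside `(-1, 1)` has vanishing entropy. -/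
theorem topEntropy_foldMap_of_monotone {a b c d : ℝ} (hdet : a * d - b * c ≠ 0)
    (hα : 0 ≤ ((c - a) * -1 + (d - b)) * ((c - a) * 1 + (d - b)))
    (hβ : 0 ≤ ((c + a) * -1 + (d + b)) * ((c + a) * 1 + (d + b))) :
    topEntropy (foldMap a b c d) = 0 := by
  have key : ∀ r s : ℝ, 0 ≤ (r * -1 + s) * (r * 1 + s) → ∀ x ∈ Icc (-1 : ℝ) 1,
      ∀ y ∈ Icc (-1 : ℝ) 1, 0 ≤ (r * x + s) * (r * y + s) := by
    intro r s hrs x hx y hy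
    -- Interpolation from the endpoints: an affine function whose values at `±1` do not have
    -- opposite signs has no sign change between them.
    have e : (r * x + s) * (r * y + s) = ((1 - x) * (1 - y) * (r * -1 + s) ^ 2
        + ((1 - x) * (1 + y) + (1 + x) * (1 - y)) * ((r * -1 + s) * (r * 1 + s))
        + (1 + x) * (1 + y) * (r * 1 + s) ^ 2) / 4 := by ring
    rw [e]
    have a1 : 0 ≤ 1 - x := by linarith [hx.2]
    have a2 : 0 ≤ 1 - y := by linarith [hy.2]
    have a3 : 0 ≤ 1 + x := by linarith [hx.1]
    have a4 : 0 ≤ 1 + y := by linarith [hy.1]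
    positivity
  refine topEntropy_foldMap_eq_zero hdet (K := Icc (-1) 1) (fun x _ => foldFun_mem_Icc _ _ _ _ x)
    ?_ (by simp)
  intro x hx y hy he
  by_contra hxy
  exact foldFun_ne hdet hxy (key _ _ hα x hx y hy) (key _ _ hβ x hx y hy) he

/-! ### Full horseshoes. -/

theorem wordPoint_mem {X : Type*} {s : Set X} {z : X} {g₀ g₁ : X → X} (hz : z ∈ s)
    (h₀ : MapsTo g₀ s s) (h₁ : MapsTo g₁ s s) (S : Finset ℕ) (j : ℕ) :
    wordPoint z g₀ g₁ S j ∈ s := by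
  induction j with
  | zero => exact hz
  | succ j ih =>
    rw [wordPoint]
    split_ifs
    · exact h₁ ih
    · exact h₀ ih

theorem wordPoint_map {X Y : Type*} {z : X} {g₀ g₁ : X → X} {G₀ G₁ : Y → Y} (φ : X → Y)
    (h₀ : ∀ x, φ (g₀ x) = G₀ (φ x)) (h₁ : ∀ x, φ (g₁ x) = G₁ (φ x)) (S : Finset ℕ) (j : ℕ) :
    wordPoint (φ z) G₀ G₁ S j = φ (wordPoint z g₀ g₁ S j) := by
  induction j with
  | zero => rfl
  | succ j ih =>
    rw [wordPoint, wordPoint, ih]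
    split_ifs
    · rw [h₁]
    · rw [h₀]

/-- Points of a full horseshoe whose itineraries have prescribed letters in the positions divisible
by `k` stay away from the critical value. -/
theorem exists_gap_of_horseshoe {F : ℝ → ℝ} (hF : Continuous F) {c : ℝ} (hc : c ∈ Ioo (-1 : ℝ) 0)
    (hF1 : 0 ≤ F (-1)) (hF0 : F 0 = 0) {g₀ g₁ : ℝ → ℝ}
    (hg₀ : ∀ u ∈ Icc (-1 : ℝ) 0, g₀ u ∈ Icc (-1) c ∧ F (g₀ u) = u)
    (hg₁ : ∀ u ∈ Icc (-1 : ℝ) 0, g₁ u ∈ Icc c 0 ∧ F (g₁ u) = u) {k : ℕ} (hk : 0 < k) :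
    ∃ δ > 0, ∀ S : Finset ℕ, (∀ i ∈ S, ¬ k ∣ i) → ∀ j, -1 + δ ≤ wordPoint c g₀ g₁ S j := by
  have hmem : ∀ S j, wordPoint c g₀ g₁ S j ∈ Icc (-1 : ℝ) 0 :=
    wordPoint_mem ⟨hc.1.le, hc.2.le⟩ (fun u hu => ⟨(hg₀ u hu).1.1, (hg₀ u hu).1.2.trans hc.2.le⟩)
      fun u hu => ⟨hc.1.le.trans (hg₁ u hu).1.1, (hg₁ u hu).1.2⟩
  have hstep : ∀ S j, F (wordPoint c g₀ g₁ S (j + 1)) = wordPoint c g₀ g₁ S j := by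
    intro S j
    rw [wordPoint]
    split_ifs
    · exact (hg₁ _ (hmem S j)).2
    · exact (hg₀ _ (hmem S j)).2
  -- Truncating at `0` changes nothing along the word points, but sends `-1` to the fixed point `0`
  -- even if `F (-1) > 0`.
  let F' : ℝ → ℝ := fun x => min (F x) 0
  have hF' : Continuous F' := hF.min continuous_const
  have hiter : ∀ S l j, F'^[l] (wordPoint c g₀ g₁ S (l + j)) = wordPoint c g₀ g₁ S j := by
    intro S l
    induction l with
    | zero => intro j; simp
    | succ l ih =>
      intro j
      have : F' (wordPoint c g₀ g₁ S (l + j + 1)) = wordPoint c g₀ g₁ S (l + j) := by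
        change min (F _) 0 = _
        rw [hstep, min_eq_left (hmem S _).2]
      rw [Function.iterate_succ_apply, show l + 1 + j = l + j + 1 by ring, this, ih]
  have hzero : ∀ l, F'^[l] 0 = 0 := fun l => by
    refine Function.iterate_fixed ?_ l
    change min (F 0) 0 = 0
    rw [hF0, min_self]
  -- A point very close to `-1` is mapped close to `0`, and so spends its next `k` iterates to the
  -- right of `c`.
  have hev : ∀ᶠ u in 𝓝 (-1 : ℝ), u < c ∧ ∀ l ∈ Finset.range k, c < F'^[l + 1] u := by
    refine (eventually_lt_nhds hc.1).and ((eventually_all_finset _).2 fun l _ => ?_)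
    refine (hF'.iterate (l + 1)).continuousAt.eventually (lt_mem_nhds ?_)
    rw [Function.iterate_succ_apply]
    have : F' (-1) = 0 := min_eq_right hF1
    rw [this, hzero]
    exact hc.2
  obtain ⟨δ, hδ, hball⟩ := Metric.eventually_nhds_iff.1 hev
  refine ⟨δ, hδ, fun S hS j => ?_⟩
  by_contra! hlt
  have hd : dist (wordPoint c g₀ g₁ S j) (-1) < δ := by
    rw [Real.dist_eq, abs_of_nonneg (by linarith [(hmem S j).1])]
    linarith
  obtain ⟨h1, h2⟩ := hball hd
  -- Yet among the `k` successors of a word point there is either the base point `c` or a point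
  -- produced by `g₀` at a multiple of `k`; both are at most `c`.
  have hex : ∃ l i, l < k ∧ j = l + 1 + i ∧ wordPoint c g₀ g₁ S i ≤ c := by
    have hj0 : j ≠ 0 := by
      rintro rfl
      exact h1.ne rfl
    by_cases hjk : j ≤ k
    · exact ⟨j - 1, 0, by omega, by omega, le_rfl⟩
    · have hdm := Nat.div_add_mod (j - 2) k
      have hml := Nat.mod_lt (j - 2) hk
      set i := k * ((j - 2) / k) with hi
      refine ⟨j - 2 - i, i + 1, by omega, by omega, ?_⟩
      have hiS : i ∉ S := fun h => hS i h ⟨_, hi⟩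
      rw [wordPoint, if_neg hiS]
      exact (hg₀ _ (hmem S i)).1.2
  obtain ⟨l, i, hl, rfl, hle⟩ := hex
  have h3 := h2 l (Finset.mem_range.2 hl)
  rw [hiter] at h3
  exact h3.not_ge hle

/-- An interval map with a full horseshoe, possibly with a critical point at the common end of the
two branches, has entropy at least `log 2`. -/
theorem log_two_le_topEntropy_of_horseshoe {T : OnePoint ℝ → OnePoint ℝ} {F : ℝ → ℝ}
    (hTF : ∀ x : ℝ, T x = (F x : OnePoint ℝ)) (hF : Continuous F) {c : ℝ}
    (hc : c ∈ Ioo (-1 : ℝ) 0) (hFc : F c = -1) (hF1 : 0 ≤ F (-1)) (hF0 : F 0 = 0) :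
    ((Real.log 2 : ℝ) : EReal) ≤ topEntropy T := by
  have hex₀ : ∀ u ∈ Icc (-1 : ℝ) 0, ∃ x, x ∈ Icc (-1) c ∧ F x = u := fun u hu =>
    intermediate_value_Icc' hc.1.le hF.continuousOn ⟨hFc.le.trans hu.1, hu.2.trans hF1⟩
  have hex₁ : ∀ u ∈ Icc (-1 : ℝ) 0, ∃ x, x ∈ Icc c 0 ∧ F x = u := fun u hu =>
    intermediate_value_Icc hc.2.le hF.continuousOn ⟨hFc.le.trans hu.1, hu.2.trans hF0.ge⟩
  choose! g₀ hg₀ using hex₀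
  choose! g₁ hg₁ using hex₁
  have hmem : ∀ S j, wordPoint c g₀ g₁ S j ∈ Icc (-1 : ℝ) 0 :=
    wordPoint_mem ⟨hc.1.le, hc.2.le⟩ (fun u hu => ⟨(hg₀ u hu).1.1, (hg₀ u hu).1.2.trans hc.2.le⟩)
      fun u hu => ⟨hc.1.le.trans (hg₁ u hu).1.1, (hg₁ u hu).1.2⟩
  -- The value assigned at `∞` plays no role, as all word points are real.
  let lift : (ℝ → ℝ) → OnePoint ℝ → OnePoint ℝ := fun g p => (g (p.elim 0 id) : OnePoint ℝ)
  have hword : ∀ S j, wordPoint (c : OnePoint ℝ) (lift g₀) (lift g₁) S j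
      = ((wordPoint c g₀ g₁ S j : ℝ) : OnePoint ℝ) :=
    wordPoint_map ((↑) : ℝ → OnePoint ℝ) (fun _ => rfl) fun _ => rfl
  refine log_two_le_topEntropy (z := (c : OnePoint ℝ)) (g₀ := lift g₀) (g₁ := lift g₁) ?_ ?_
  · intro S j
    rw [hword, hword, hTF, OnePoint.coe_eq_coe, wordPoint]
    split_ifs
    · exact (hg₁ _ (hmem S j)).2
    · exact (hg₀ _ (hmem S j)).2
  · intro k hk
    obtain ⟨δ, hδ, hgap⟩ := exists_gap_of_horseshoe hF hc hF1 hF0 hg₀ hg₁ hk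
    -- The branches come together only at `c`, where `F` is `-1`. Words stay `δ` away from `-1`, so
    -- both preimages stay `η` away from `c`, on opposite sides.
    obtain ⟨η, hη, hball⟩ := Metric.eventually_nhds_iff.1
      (hF.continuousAt.eventually (gt_mem_nhds (show F c < -1 + δ by linarith)))
    set A : Set (OnePoint ℝ) := (↑) '' Icc (-1) (c - η) with hA
    set B : Set (OnePoint ℝ) := (↑) '' Icc (c + η) 0 with hB
    have hcl : ∀ a b : ℝ, IsClosed (((↑) : ℝ → OnePoint ℝ) '' Icc a b) := fun a b =>
      OnePoint.isClosed_image_coe.2 ⟨isClosed_Icc, isCompact_Icc⟩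
    have hAB : ∀ x ∈ A, x ∉ B := by
      rintro _ ⟨x, hx, rfl⟩ ⟨y, hy, hxy⟩
      rw [OnePoint.coe_eq_coe] at hxy
      linarith [hx.2, hy.1]
    refine ⟨(A ×ˢ B ∪ B ×ˢ A)ᶜ, ?_, ?_, ?_⟩
    · exact (((hcl _ _).prod (hcl _ _)).union ((hcl _ _).prod (hcl _ _))).isOpen_compl
    · rintro x (⟨h1, h2⟩ | ⟨h1, h2⟩)
      · exact hAB x h1 h2
      · exact hAB x h2 h1
    · intro S hS j
      have hu := hgap S hS j
      rw [hword]
      set u := wordPoint c g₀ g₁ S j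
      obtain ⟨h1, e1⟩ := hg₀ u (hmem S j)
      obtain ⟨h2, e2⟩ := hg₁ u (hmem S j)
      have hfar : ∀ x, F x = u → η ≤ |x - c| := by
        intro x hx
        by_contra! h
        have := hball (y := x) (by rwa [Real.dist_eq])
        linarith
      have f1 := hfar _ e1
      have f2 := hfar _ e2
      rw [abs_of_nonpos (by linarith [h1.2])] at f1
      rw [abs_of_nonneg (by linarith [h2.1])] at f2
      have m1 : lift g₀ (u : OnePoint ℝ) ∈ A := ⟨g₀ u, ⟨h1.1, by linarith⟩, rfl⟩
      have m2 : lift g₁ (u : OnePoint ℝ) ∈ B := ⟨g₁ u, ⟨by linarith, h2.2⟩, rfl⟩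
      exact ⟨fun h => h (Or.inl ⟨m1, m2⟩), fun h => h (Or.inr ⟨m2, m1⟩)⟩

/-! ### Reduction of the normal forms to the three parameter domains. -/

theorem mobiusConj_neg {μ : ℝ} (hμ : μ ≠ 0) (t : ℝ) :
    MobiusConj (foldMap μ 0 t 2) (foldMap μ 0 (-t) 2) := by
  have hg : (-1 : ℝ) * 1 - 0 * 0 ≠ 0 := by norm_num
  have hdet : μ * 2 - 0 * t ≠ 0 := by simpa using hμ
  refine ⟨gl (-1) 0 0 1 hg, fun p => ?_⟩
  obtain ⟨x, y, h, rfl⟩ := exists_hpt p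
  rw [gl_smul_hpt hg h, foldMap_hpt _ _ _ _ h, foldMap_hpt _ _ _ _ (linear_ne_zero hg h),
    gl_smul_hpt hg (Or.inr (fold_denom_pos hdet h).ne')]
  congr 1 <;> ring

/-- The odd maps `2μx·2 / (μ²x² + 4)` have vanishing entropy. -/
theorem topEntropy_foldMap_odd {μ : ℝ} (hμ : μ ≠ 0) : topEntropy (foldMap μ 0 0 2) = 0 := by
  have hdet : μ * 2 - 0 * 0 ≠ 0 := by simpa using hμ
  have hpos : ∀ x : ℝ, 0 < (μ * x) ^ 2 + 4 := fun x => by positivity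
  have hF : ∀ x, foldFun μ 0 0 2 x = 4 * (μ * x) / ((μ * x) ^ 2 + 4) := by
    intro x
    rw [foldFun]
    congr 1 <;> ring
  -- The critical points are `±2/μ`. `K` is the union of the outer laps in `[-1, 1]`; equal values
  -- there lie in the same lap, since the value has the sign of `μx`. The complement is the central
  -- lap.
  refine topEntropy_foldMap_eq_zero hdet (K := {x | x ∈ Icc (-1 : ℝ) 1 ∧ 2 ≤ |μ * x|}) ?_ ?_ ?_
  · rintro x ⟨hx, h2⟩
    refine ⟨foldFun_mem_Icc _ _ _ _ x, ?_⟩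
    have hx1 : |x| ≤ 1 := abs_le.2 hx
    rw [hF, abs_mul, abs_div, abs_mul, abs_of_pos (hpos x), abs_of_pos (show (0 : ℝ) < 4 by norm_num),
      ← mul_div_assoc, le_div_iff₀ (hpos x), ← sq_abs (μ * x), abs_mul]
    rw [abs_mul] at h2
    have hm : 0 < |μ| := abs_pos.2 hμ
    generalize |μ| = m at *
    generalize |x| = w at *
    have h3 : 2 ≤ m := h2.trans (mul_le_of_le_one_right hm.le hx1)
    -- Invariance of `K` amounts to `mw · m(2 - w) ≥ 4`, a product of two factors that are at least
    -- `2`.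
    have h4 : 2 ≤ m * (2 - w) := by nlinarith
    nlinarith [mul_le_mul h2 h4 (by norm_num) (by linarith)]
  · rintro x ⟨_, hx⟩ y ⟨_, hy⟩ he
    by_contra hxy
    have hsign : 0 < (μ * x) * (μ * y) := by
      rw [hF, hF, div_eq_div_iff (hpos x).ne' (hpos y).ne'] at he
      have hx0 : μ * x ≠ 0 := fun h => by rw [h, abs_zero] at hx; linarith
      have h1 : (μ * y) * (μ * x) * (4 * ((μ * y) ^ 2 + 4))
          = (μ * y) ^ 2 * (4 * ((μ * x) ^ 2 + 4)) := by
        linear_combination (μ * y) * he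
      have hy0 : μ * y ≠ 0 := fun h => by rw [h, abs_zero] at hy; linarith
      have h2 : 0 < (μ * y) * (μ * x) * (4 * ((μ * y) ^ 2 + 4)) := by
        rw [h1]
        have := hpos x
        positivity
      have h3 : 0 < 4 * ((μ * y) ^ 2 + 4) := by positivity
      rw [mul_comm (μ * x)]
      exact pos_of_mul_pos_left h2 h3.le
    have hxy2 : 4 ≤ (μ * x) * (μ * y) := by
      rw [← abs_of_pos hsign, abs_mul (μ * x)]
      nlinarith
    have h4 : 2 * |μ * x + μ * y| ≤ 4 + (μ * x) * (μ * y) := by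
      have : |μ * x + μ * y| = |μ * x| + |μ * y| := by
        rcases lt_or_ge 0 (μ * x) with h | h
        · have : 0 < μ * y := pos_of_mul_pos_right hsign h.le
          rw [abs_of_pos h, abs_of_pos this, abs_of_pos (by linarith)]
        · have : μ * y ≤ 0 := by nlinarith
          rw [abs_of_nonpos h, abs_of_nonpos this, abs_of_nonpos (by linarith)]
          ring
      rw [this, ← abs_of_pos hsign, abs_mul (μ * x)]
      nlinarith
    have h5 := abs_le.1 (show |μ * x + μ * y| ≤ (4 + (μ * x) * (μ * y)) / 2 by linarith)
    exact foldFun_ne hdet hxy (by linarith [h5.2]) (by linarith [h5.1]) he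
  · rintro x ⟨hxI, hx⟩ y ⟨hyI, hy⟩ he
    by_contra hxy
    have hx2 : |μ * x| < 2 := by
      by_contra! h
      exact hx ⟨hxI, h⟩
    have hy2 : |μ * y| < 2 := by
      by_contra! h
      exact hy ⟨hyI, h⟩
    rw [abs_lt] at hx2 hy2
    refine foldFun_ne hdet hxy (mul_nonneg ?_ ?_) (mul_nonneg ?_ ?_) he <;> linarith

/-- Having a conjugate in one of the three families, or entropy `0`, or entropy `log 2`. -/
def HasModel (T : OnePoint ℝ → OnePoint ℝ) : Prop :=
  (∃ μ t : ℝ, (μ, t) ∈ U₁ ∪ U₂ ∪ U₃ ∧ MobiusConj T (foldMap μ 0 t 2)) ∨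
    topEntropy T = 0 ∨ topEntropy T = ((Real.log 2 : ℝ) : EReal)

theorem HasModel.of_conj {S T : OnePoint ℝ → OnePoint ℝ} (h : HasModel T) (hST : MobiusConj S T) :
    HasModel S := by
  rcases h with ⟨μ, t, hU, hT⟩ | h
  · exact Or.inl ⟨μ, t, hU, hST.trans hT⟩
  · right
    rwa [hST.topEntropy_eq]

theorem mobiusConj_refl (T : OnePoint ℝ → OnePoint ℝ) : MobiusConj T T :=
  ⟨1, fun p => by simp⟩

/-- For `t ≥ 2` one has `f(-1) ≥ 0 = f(0)`, while the critical point `-2/(μ + t)` between them has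
value `-1`: both laps on `[-1, 0]` cover `[-1, 0]`. -/
theorem hasModel_of_pos {μ : ℝ} (hμ : 0 < μ) (t : ℝ) : HasModel (foldMap μ 0 t 2) := by
  wlog ht : 0 ≤ t generalizing t
  · exact (this (-t) (by linarith)).of_conj (mobiusConj_neg hμ.ne' t)
  have hdet : μ * 2 - 0 * t ≠ 0 := by simpa using hμ.ne'
  rcases ht.eq_or_lt with rfl | ht0
  · exact Or.inr (Or.inl (topEntropy_foldMap_odd hμ.ne'))
  rcases le_or_gt (μ + t) 2 with h1 | h1
  · refine Or.inr (Or.inl (topEntropy_foldMap_of_monotone hdet (mul_nonneg ?_ ?_)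
      (mul_nonneg ?_ ?_))) <;> linarith
  rcases lt_or_ge t 2 with h2 | h2
  · exact Or.inl ⟨μ, t, Or.inl (Or.inl ⟨hμ, ht0, by dsimp only; linarith, h2⟩), mobiusConj_refl _⟩
  · refine Or.inr (Or.inr (le_antisymm (topEntropy_foldMap_le hdet) ?_))
    refine log_two_le_topEntropy_of_horseshoe (F := foldFun μ 0 t 2) (c := -2 / (μ + t))
      (foldMap_coe hdet) (continuous_foldFun hdet) ⟨?_, ?_⟩ ?_ ?_ ?_
    · rw [lt_div_iff₀ (by linarith)]; linarith
    · exact div_neg_of_neg_of_pos (by norm_num) (by linarith)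
    · have h := foldFun_add_one hdet (-2 / (μ + t))
      have h0 : (t + μ) * (-2 / (μ + t)) + (2 + 0) = 0 := by
        have : μ + t ≠ 0 := by linarith
        field_simp
        ring
      rw [h0] at h
      simp only [ne_eq, OfNat.ofNat_ne_zero, not_false_eq_true, zero_pow, zero_div] at h
      linarith
    · rw [foldFun]
      refine div_nonneg ?_ (foldFun_denom_pos hdet _).le
      nlinarith
    · rw [foldFun]; simp

/-- The hypotheses say `|v| < |u|` at the fixed point `p`. As the determinant `2μ` is negative, the
multiplier at `p` is positive, and taking `p` as the new origin leads to `hasModel_of_pos`. -/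
theorem hasModel_of_fixed {μ t p : ℝ} (hμ : μ < 0) (hp0 : p ≠ 0)
    (hp : p * ((μ * p) ^ 2 + (t * p + 2) ^ 2) = 2 * (μ * p) * (t * p + 2))
    (h1 : t * p + 2 < |μ * p|) (h2 : -|μ * p| < t * p + 2) : HasModel (foldMap μ 0 t 2) := by
  have hdet : μ * 2 - 0 * t ≠ 0 := by simpa using hμ.ne
  have hv : t * p + 2 ≠ 0 := by
    intro h
    rw [h] at hp
    have h3 : p * (μ * p) ^ 2 = 0 := by linear_combination hp
    have h4 : p * (μ * p) ^ 2 ≠ 0 := mul_ne_zero hp0 (pow_ne_zero 2 (mul_ne_zero hμ.ne hp0))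
    exact h4 h3
  have hq1 : 1 < (μ * p / (t * p + 2)) ^ 2 := by
    rw [div_pow, one_lt_div (by positivity)]
    exact sq_lt_sq.2 (abs_lt.2 ⟨h2, h1⟩)
  obtain ⟨μ', t', hconj, hpos⟩ := mobiusConj_normal_of_fixed (p := p) (q := μ * p / (t * p + 2)) hdet
    (by
      generalize μ * p = n at *
      generalize t * p + 2 = m at *
      field_simp
      linear_combination hp)
    (by rw [add_zero]; exact (div_mul_cancel₀ _ hv).symm) hq1.ne'
  refine (hasModel_of_pos ?_ t').of_conj hconj
  refine pos_of_mul_pos_left hpos ?_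
  nlinarith

/-- Outside `U₂` and `U₃`, and apart from the odd and monotone cases, a second fixed point with
positive multiplier is exhibited. -/
theorem hasModel_of_neg {μ : ℝ} (hμ : μ < 0) (t : ℝ) : HasModel (foldMap μ 0 t 2) := by
  wlog ht : t ≤ 0 generalizing t
  · exact (this (-t) (by linarith)).of_conj (mobiusConj_neg hμ.ne t)
  have hdet : μ * 2 - 0 * t ≠ 0 := by simpa using hμ.ne
  rcases ht.eq_or_lt with rfl | ht0
  · exact Or.inr (Or.inl (topEntropy_foldMap_odd hμ.ne))
  rcases le_or_gt (-2) (μ + t) with h1 | h1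
  · refine Or.inr (Or.inl (topEntropy_foldMap_of_monotone hdet (mul_nonneg ?_ ?_)
      (mul_nonneg ?_ ?_))) <;> linarith
  rcases lt_or_ge μ (t - 2) with h2 | h2
  · rcases lt_or_ge μ (1 - t ^ 2 / 4) with h3 | h3
    · exact Or.inl ⟨μ, t, Or.inr ⟨hμ, ht0, lt_min h2 h3⟩, mobiusConj_refl _⟩
    · have hD : 0 ≤ t ^ 2 - 4 + 4 * μ := by linarith
      have hr := Real.sq_sqrt hD
      have hr0 := Real.sqrt_nonneg (t ^ 2 - 4 + 4 * μ)
      set r := Real.sqrt (t ^ 2 - 4 + 4 * μ)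
      have hden : 0 < μ ^ 2 + t ^ 2 := by
        have := hμ.ne
        positivity
      -- The nonzero fixed points are the roots of the quadratic in `hquad`, whose reduced
      -- discriminant is `μ²(t² - 4 + 4μ)`. Hence `U₃` asks for `0` to be the only real one. The
      -- larger root is taken; it is positive.
      obtain ⟨p, hpdef⟩ : ∃ p, p * (μ ^ 2 + t ^ 2) = -t * (2 - μ) - μ * r :=
        ⟨_, div_mul_cancel₀ _ hden.ne'⟩
      have hp0 : 0 < p := by
        refine pos_of_mul_pos_left (b := μ ^ 2 + t ^ 2) ?_ hden.le
        rw [hpdef]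
        nlinarith
      have hquad : (μ ^ 2 + t ^ 2) * p ^ 2 + (4 * t - 2 * μ * t) * p + (4 - 4 * μ) = 0 := by
        have : (μ ^ 2 + t ^ 2) * ((μ ^ 2 + t ^ 2) * p ^ 2 + (4 * t - 2 * μ * t) * p + (4 - 4 * μ))
            = 0 := by
          linear_combination (p * (μ ^ 2 + t ^ 2) + t * (2 - μ) - μ * r) * hpdef + μ ^ 2 * hr
        exact (mul_eq_zero.1 this).resolve_left hden.ne'
      have hp : p * ((μ * p) ^ 2 + (t * p + 2) ^ 2) = 2 * (μ * p) * (t * p + 2) := by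
        linear_combination p * hquad
      have hv : t * p + 2 < 0 := by
        have h4 : 0 < p * ((μ * p) ^ 2 + (t * p + 2) ^ 2) := by
          have : μ * p ≠ 0 := mul_ne_zero hμ.ne hp0.ne'
          positivity
        rw [hp] at h4
        have h5 : μ * p < 0 := mul_neg_of_neg_of_pos hμ hp0
        by_contra! h6
        nlinarith
      have habs : |μ * p| = -(μ * p) := abs_of_neg (mul_neg_of_neg_of_pos hμ hp0)
      refine hasModel_of_fixed hμ hp0.ne' hp ?_ ?_
      · exact hv.trans_le (abs_nonneg _)
      · rw [habs]
        nlinarith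
  · rcases lt_trichotomy μ (t + 2) with h3 | h3 | h3
    · refine Or.inl ⟨μ, t, Or.inl (Or.inr ⟨hμ, ht0, h2, ?_⟩), mobiusConj_refl _⟩
      dsimp only
      rw [lt_neg, abs_lt]
      constructor <;> linarith
    -- On this boundary `1` is a critical fixed point. The third fixed point is explicit: there `u/v
    -- = 1 - μ`, so `p = 2q/(1 + q²)` with `q = 1 - μ`.
    · have ht' : t = μ - 2 := by linarith
      subst ht'
      have hden : 0 < μ ^ 2 - 2 * μ + 2 := by nlinarith
      obtain ⟨p, hp⟩ : ∃ p, p * (μ ^ 2 - 2 * μ + 2) = 2 - 2 * μ :=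
        ⟨_, div_mul_cancel₀ _ hden.ne'⟩
      obtain ⟨μ', t', hconj, hpos⟩ := mobiusConj_normal_of_fixed (p := p) (q := 1 - μ) hdet
        (by linear_combination hp) (by linear_combination hp) (by nlinarith)
      refine (hasModel_of_pos ?_ t').of_conj hconj
      refine pos_of_mul_pos_left hpos ?_
      nlinarith
    -- Both critical points lie in `(0, 1)`, and the map rises from `-1` to `1` between them, so it
    -- crosses the diagonal on this increasing lap.
    · have hl : 0 < -(μ + t) := by linarith
      have hr : 0 < μ - t := by linarith
      have hlt : 2 / -(μ + t) < 2 / (μ - t) :=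
        div_lt_div_of_pos_left (by norm_num) hr (by linarith)
      have hl0 : 0 < 2 / -(μ + t) := by positivity
      have hr1 : 2 / (μ - t) < 1 := by rw [div_lt_one hr]; linarith
      have el : foldFun μ 0 t 2 (2 / -(μ + t)) = -1 := by
        have h := foldFun_add_one hdet (2 / -(μ + t))
        have h0 : (t + μ) * (2 / -(μ + t)) + (2 + 0) = 0 := by
          linear_combination -(div_mul_cancel₀ 2 hl.ne')
        rw [h0] at h
        simp only [ne_eq, OfNat.ofNat_ne_zero, not_false_eq_true, zero_pow, zero_div] at h
        linarith
      have er : foldFun μ 0 t 2 (2 / (μ - t)) = 1 := by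
        have h := one_sub_foldFun hdet (2 / (μ - t))
        have h0 : (t - μ) * (2 / (μ - t)) + (2 - 0) = 0 := by
          linear_combination -(div_mul_cancel₀ 2 hr.ne')
        rw [h0] at h
        simp only [ne_eq, OfNat.ofNat_ne_zero, not_false_eq_true, zero_pow, zero_div] at h
        linarith
      obtain ⟨p, hp, hfix⟩ := intermediate_value_Ioo hlt.le
        ((continuous_foldFun hdet).sub continuous_id).continuousOn
        (show (0 : ℝ) ∈ Ioo (foldFun μ 0 t 2 (2 / -(μ + t)) - 2 / -(μ + t))
          (foldFun μ 0 t 2 (2 / (μ - t)) - 2 / (μ - t)) from ⟨by linarith, by linarith⟩)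
      have hfix : foldFun μ 0 t 2 p = p := sub_eq_zero.1 hfix
      rw [foldFun, add_zero, div_eq_iff (by simpa using (foldFun_denom_pos hdet p).ne')] at hfix
      have hp0 : 0 < p := hl0.trans hp.1
      have habs : |μ * p| = -(μ * p) := abs_of_neg (mul_neg_of_neg_of_pos hμ hp0)
      have h5 := (div_lt_iff₀ hl).1 hp.1
      have h6 := (lt_div_iff₀ hr).1 hp.2
      refine hasModel_of_fixed hμ hp0.ne' hfix.symm ?_ ?_ <;> rw [habs] <;> linarith

theorem hasModel_foldMap {a b c d : ℝ} (hdet : a * d - b * c ≠ 0) : HasModel (foldMap a b c d) := by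
  by_cases hα : 0 ≤ ((c - a) * -1 + (d - b)) * ((c - a) * 1 + (d - b))
  · by_cases hβ : 0 ≤ ((c + a) * -1 + (d + b)) * ((c + a) * 1 + (d + b))
    · exact Or.inr (Or.inl (topEntropy_foldMap_of_monotone hdet hα hβ))
    · obtain ⟨p, hp, hfix⟩ := exists_fixed_of_critical hdet (Or.inr (not_le.1 hβ))
      obtain ⟨μ, t, hμ, hconj⟩ := exists_mobiusConj_normal_of_fixed hdet hp hfix
      exact HasModel.of_conj (hμ.lt_or_gt.elim (fun h => hasModel_of_neg h t)
        fun h => hasModel_of_pos h t) hconj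
  · obtain ⟨p, hp, hfix⟩ := exists_fixed_of_critical hdet (Or.inl (not_le.1 hα))
    obtain ⟨μ, t, hμ, hconj⟩ := exists_mobiusConj_normal_of_fixed hdet hp hfix
    exact HasModel.of_conj (hμ.lt_or_gt.elim (fun h => hasModel_of_neg h t)
      fun h => hasModel_of_pos h t) hconj

/-! ### Laps of the maps in the three families. -/

/-- With `α = v - u` and `β = v + u`, the last factor in `foldFun_sub` is half of `α(x)β(y) +
β(x)α(y)`. The direction of monotonicity is thus read off from the signs of two affine functions on
each lap. -/
theorem foldFun_lt {a b c d : ℝ} (hdet : a * d - b * c ≠ 0) {x y : ℝ} (hxy : x < y)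
    (hα : 0 ≤ ((c - a) * x + (d - b)) * ((c - a) * y + (d - b)))
    (hβ : 0 ≤ ((c + a) * x + (d + b)) * ((c + a) * y + (d + b)))
    (h : 0 ≤ (a * d - b * c) * (((c - a) * x + (d - b)) * ((c + a) * y + (d + b))
      + ((c + a) * x + (d + b)) * ((c - a) * y + (d - b)))) :
    foldFun a b c d x < foldFun a b c d y := by
  refine lt_of_le_of_ne (sub_nonpos.1 ?_) (foldFun_ne hdet hxy.ne hα hβ)
  rw [foldFun_sub hdet]
  refine div_nonpos_of_nonpos_of_nonneg ?_
    (mul_pos (foldFun_denom_pos hdet x) (foldFun_denom_pos hdet y)).le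
  have := mul_nonneg (sub_nonneg.2 hxy.le) h
  linarith

theorem foldFun_gt {a b c d : ℝ} (hdet : a * d - b * c ≠ 0) {x y : ℝ} (hxy : x < y)
    (hα : 0 ≤ ((c - a) * x + (d - b)) * ((c - a) * y + (d - b)))
    (hβ : 0 ≤ ((c + a) * x + (d + b)) * ((c + a) * y + (d + b)))
    (h : (a * d - b * c) * (((c - a) * x + (d - b)) * ((c + a) * y + (d + b))
      + ((c + a) * x + (d + b)) * ((c - a) * y + (d - b))) ≤ 0) :
    foldFun a b c d y < foldFun a b c d x := by
  refine lt_of_le_of_ne (sub_nonneg.1 ?_) (foldFun_ne hdet hxy.ne hα hβ).symm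
  rw [foldFun_sub hdet]
  refine div_nonneg ?_ (mul_pos (foldFun_denom_pos hdet x) (foldFun_denom_pos hdet y)).le
  have := mul_nonneg (sub_nonneg.2 hxy.le) (neg_nonneg.2 h)
  linarith

theorem normalFun_eq (μ t : ℝ) : normalFun μ t = foldFun μ 0 t 2 :=
  funext fun x => normalFun_eq_foldFun μ t x

theorem isUnimodalOn_of_mem_U₁ {μ t : ℝ} (h : (μ, t) ∈ U₁) :
    IsUnimodalOn (normalFun μ t) (-1) 0 := by
  obtain ⟨hμ, ht, h1, h2⟩ := h
  dsimp only at hμ ht h1 h2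
  have hdet : μ * 2 - 0 * t ≠ 0 := by simpa using hμ.ne'
  have hs : 0 < μ + t := by linarith
  have hc : ∀ x, x ≤ -2 / (μ + t) ↔ (t + μ) * x + 2 ≤ 0 := fun x => by
    rw [le_div_iff₀ hs]
    constructor <;> intro h <;> linarith
  have hc' : ∀ x, -2 / (μ + t) ≤ x ↔ 0 ≤ (t + μ) * x + 2 := fun x => by
    rw [div_le_iff₀ hs]
    constructor <;> intro h <;> linarith
  -- Only the critical point with value `-1` turns the map here: the other affine form is positive
  -- at both ends of `[-1, 0]`.
  have hα : ∀ x, -1 ≤ x → x ≤ 0 → 0 ≤ (t - μ) * x + (2 - 0) := by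
    intro x hx1 hx0
    nlinarith
  have hc1 : -1 < -2 / (μ + t) := by rw [lt_div_iff₀ hs]; linarith
  have hc0 : -2 / (μ + t) < 0 := div_neg_of_neg_of_pos (by norm_num) hs
  rw [normalFun_eq]
  refine ⟨fun x hx => ⟨(foldFun_mem_Icc _ _ _ _ x).1, ?_⟩, (continuous_foldFun hdet).continuousOn,
    -2 / (μ + t), ⟨hc1, hc0⟩, Or.inr ⟨?_, ?_⟩⟩
  · refine div_nonpos_of_nonpos_of_nonneg ?_ (foldFun_denom_pos hdet x).le
    have h3 : 0 ≤ t * x + 2 := by nlinarith [hx.1]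
    have h4 : 2 * (μ * x + 0) ≤ 0 := by nlinarith [hx.2]
    exact mul_nonpos_of_nonpos_of_nonneg h4 h3
  · rintro x ⟨hx1, hx2⟩ y ⟨hy1, hy2⟩ hxy
    have ax := hα x hx1 (hx2.trans hc0.le)
    have ay := hα y hy1 (hy2.trans hc0.le)
    have bx := (hc x).1 hx2
    have hby := (hc y).1 hy2
    rw [← add_zero (2 : ℝ)] at bx hby
    refine foldFun_gt hdet hxy (mul_nonneg ax ay) (mul_nonneg_of_nonpos_of_nonpos bx hby) ?_
    refine mul_nonpos_of_nonneg_of_nonpos (by linarith) (add_nonpos ?_ ?_)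
    · exact mul_nonpos_of_nonneg_of_nonpos ax hby
    · exact mul_nonpos_of_nonpos_of_nonneg bx ay
  · rintro x ⟨hx1, hx2⟩ y ⟨hy1, hy2⟩ hxy
    have ax := hα x (hc1.le.trans hx1) hx2
    have ay := hα y (hc1.le.trans hy1) hy2
    have bx := (hc' x).1 hx1
    have hby := (hc' y).1 hy1
    rw [← add_zero (2 : ℝ)] at bx hby
    refine foldFun_lt hdet hxy (mul_nonneg ax ay) (mul_nonneg bx hby) ?_
    exact mul_nonneg (by linarith) (add_nonneg (mul_nonneg ax hby) (mul_nonneg bx ay))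

theorem isUnimodalOn_of_mem_U₂ {μ t : ℝ} (h : (μ, t) ∈ U₂) :
    IsUnimodalOn (normalFun μ t) (-1) 1 := by
  obtain ⟨hμ, ht, h1, h2⟩ := h
  dsimp only at hμ ht h1 h2
  rw [lt_neg, abs_lt] at h2
  have hdet : μ * 2 - 0 * t ≠ 0 := by simpa using hμ.ne
  have hs : 0 < -(μ + t) := by linarith
  have hc : ∀ x, x ≤ 2 / -(μ + t) ↔ 0 ≤ (t + μ) * x + 2 := fun x => by
    rw [le_div_iff₀ hs]
    constructor <;> intro h <;> linarith
  have hc' : ∀ x, 2 / -(μ + t) ≤ x ↔ (t + μ) * x + 2 ≤ 0 := fun x => by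
    rw [div_le_iff₀ hs]
    constructor <;> intro h <;> linarith
  -- `|t - μ| ≤ 2` keeps the critical point with value `1` out of the open interval; on the line `μ
  -- = t - 2` it is the endpoint `-1`.
  have hα : ∀ x, -1 ≤ x → x ≤ 1 → 0 ≤ (t - μ) * x + (2 - 0) := by
    intro x hx1 hx0
    nlinarith
  have hc1 : 2 / -(μ + t) < 1 := by rw [div_lt_iff₀ hs]; linarith
  have hc0 : 0 < 2 / -(μ + t) := by positivity
  rw [normalFun_eq]
  refine ⟨fun x _ => foldFun_mem_Icc _ _ _ _ x, (continuous_foldFun hdet).continuousOn,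
    2 / -(μ + t), ⟨by linarith, hc1⟩, Or.inr ⟨?_, ?_⟩⟩
  · rintro x ⟨hx1, hx2⟩ y ⟨hy1, hy2⟩ hxy
    have ax := hα x hx1 (hx2.trans hc1.le)
    have ay := hα y hy1 (hy2.trans hc1.le)
    have bx := (hc x).1 hx2
    have hby := (hc y).1 hy2
    rw [← add_zero (2 : ℝ)] at bx hby
    refine foldFun_gt hdet hxy (mul_nonneg ax ay) (mul_nonneg bx hby) ?_
    exact mul_nonpos_of_nonpos_of_nonneg (by linarith)
      (add_nonneg (mul_nonneg ax hby) (mul_nonneg bx ay))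
  · rintro x ⟨hx1, hx2⟩ y ⟨hy1, hy2⟩ hxy
    have ax := hα x (by linarith) hx2
    have ay := hα y (by linarith) hy2
    have bx := (hc' x).1 hx1
    have hby := (hc' y).1 hy1
    rw [← add_zero (2 : ℝ)] at bx hby
    refine foldFun_lt hdet hxy (mul_nonneg ax ay) (mul_nonneg_of_nonpos_of_nonpos bx hby) ?_
    refine mul_nonneg_of_nonpos_of_nonpos (by linarith) (add_nonpos ?_ ?_)
    · exact mul_nonpos_of_nonneg_of_nonpos ax hby
    · exact mul_nonpos_of_nonpos_of_nonneg bx ay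

theorem isPlusMinusPlusBimodalOn_of_mem_U₃ {μ t : ℝ} (h : (μ, t) ∈ U₃) :
    IsPlusMinusPlusBimodalOn (normalFun μ t) (-1) 1 := by
  obtain ⟨hμ, ht, h1⟩ := h
  dsimp only at hμ ht h1
  have h1 := h1.trans_le (min_le_left _ _)
  have hdet : μ * 2 - 0 * t ≠ 0 := by simpa using hμ.ne
  have hs : 0 < -(μ + t) := by linarith
  have hr : 0 < t - μ := by linarith
  have hc : ∀ x, x ≤ -2 / (t - μ) ↔ (t - μ) * x + 2 ≤ 0 := fun x => by
    rw [le_div_iff₀ hr]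
    constructor <;> intro h <;> linarith
  have hc' : ∀ x, -2 / (t - μ) ≤ x ↔ 0 ≤ (t - μ) * x + 2 := fun x => by
    rw [div_le_iff₀ hr]
    constructor <;> intro h <;> linarith
  have hd : ∀ x, x ≤ 2 / -(μ + t) ↔ 0 ≤ (t + μ) * x + 2 := fun x => by
    rw [le_div_iff₀ hs]
    constructor <;> intro h <;> linarith
  have hd' : ∀ x, 2 / -(μ + t) ≤ x ↔ (t + μ) * x + 2 ≤ 0 := fun x => by
    rw [div_le_iff₀ hs]
    constructor <;> intro h <;> linarith
  have hc1 : -1 < -2 / (t - μ) := by rw [lt_div_iff₀ hr]; linarith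
  have hc0 : -2 / (t - μ) < 0 := div_neg_of_neg_of_pos (by norm_num) hr
  have hd1 : 2 / -(μ + t) < 1 := by rw [div_lt_iff₀ hs]; linarith
  have hd0 : 0 < 2 / -(μ + t) := by positivity
  rw [normalFun_eq]
  refine ⟨fun x _ => foldFun_mem_Icc _ _ _ _ x, (continuous_foldFun hdet).continuousOn,
    -2 / (t - μ), 2 / -(μ + t), hc1, hc0.trans hd0, hd1, ?_, ?_, ?_⟩
  · rintro x ⟨hx1, hx2⟩ y ⟨hy1, hy2⟩ hxy
    have ax := (hc x).1 hx2
    have ay := (hc y).1 hy2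
    have bx := (hd x).1 (hx2.trans (hc0.trans hd0).le)
    have hby := (hd y).1 (hy2.trans (hc0.trans hd0).le)
    rw [← add_zero (2 : ℝ)] at bx hby
    rw [← sub_zero (2 : ℝ)] at ax ay
    refine foldFun_lt hdet hxy (mul_nonneg_of_nonpos_of_nonpos ax ay) (mul_nonneg bx hby) ?_
    refine mul_nonneg_of_nonpos_of_nonpos (by linarith) (add_nonpos ?_ ?_)
    · exact mul_nonpos_of_nonpos_of_nonneg ax hby
    · exact mul_nonpos_of_nonneg_of_nonpos bx ay
  · rintro x ⟨hx1, hx2⟩ y ⟨hy1, hy2⟩ hxy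
    have ax := (hc' x).1 hx1
    have ay := (hc' y).1 hy1
    have bx := (hd x).1 hx2
    have hby := (hd y).1 hy2
    rw [← add_zero (2 : ℝ)] at bx hby
    rw [← sub_zero (2 : ℝ)] at ax ay
    refine foldFun_gt hdet hxy (mul_nonneg ax ay) (mul_nonneg bx hby) ?_
    exact mul_nonpos_of_nonpos_of_nonneg (by linarith)
      (add_nonneg (mul_nonneg ax hby) (mul_nonneg bx ay))
  · rintro x ⟨hx1, hx2⟩ y ⟨hy1, hy2⟩ hxy
    have ax := (hc' x).1 ((hc0.trans hd0).le.trans hx1)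
    have ay := (hc' y).1 ((hc0.trans hd0).le.trans hy1)
    have bx := (hd' x).1 hx1
    have hby := (hd' y).1 hy1
    rw [← add_zero (2 : ℝ)] at bx hby
    rw [← sub_zero (2 : ℝ)] at ax ay
    refine foldFun_lt hdet hxy (mul_nonneg ax ay) (mul_nonneg_of_nonpos_of_nonpos bx hby) ?_
    refine mul_nonneg_of_nonpos_of_nonpos (by linarith) (add_nonpos ?_ ?_)
    · exact mul_nonpos_of_nonneg_of_nonpos ax hby
    · exact mul_nonpos_of_nonpos_of_nonneg bx ay

theorem ne_zero_of_mem_U {μ t : ℝ} (h : (μ, t) ∈ U₁ ∪ U₂ ∪ U₃) : μ ≠ 0 := by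
  rcases h with (h | h) | h
  · exact h.1.ne'
  · exact h.1.ne
  · exact h.1.ne

/-- Every real quadratic rational map has a conjugate in one of the three families, unless its real
entropy is `0` or `log 2`. -/
theorem realConj_or_entropy {f : RatFunc ℝ} (hf : ratDegree f = 2) :
    (∃ μ t : ℝ, (μ, t) ∈ U₁ ∪ U₂ ∪ U₃ ∧ RealConj f (normalForm μ t)) ∨
      realEntropy f = 0 ∨ realEntropy f = ((Real.log 2 : ℝ) : EReal) := by
  rcases mobiusConj_foldMap_or_entropy hf with ⟨a, b, c, d, hdet, hconj⟩ | h
  · rcases (hasModel_foldMap hdet).of_conj hconj with ⟨μ, t, hU, g, hg⟩ | h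
    · refine Or.inl ⟨μ, t, hU, g, fun p => ?_⟩
      rw [circleMap_normalForm (ne_zero_of_mem_U hU)]
      exact hg p
    · exact Or.inr h
  · exact Or.inr (Or.inr h)

end RealQuadratic

end

theorem mainTheorem9 :
    (∀ μ t : ℝ, (μ, t) ∈ RealQuadratic.U₁ →
      RealQuadratic.IsUnimodalOn (RealQuadratic.normalFun μ t) (-1) 0) ∧
    (∀ μ t : ℝ, (μ, t) ∈ RealQuadratic.U₂ →
      RealQuadratic.IsUnimodalOn (RealQuadratic.normalFun μ t) (-1) 1) ∧
    (∀ μ t : ℝ, (μ, t) ∈ RealQuadratic.U₃ →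
      RealQuadratic.IsPlusMinusPlusBimodalOn (RealQuadratic.normalFun μ t) (-1) 1) ∧
    (∀ f : RatFunc ℝ, RealQuadratic.ratDegree f = 2 →
      (∃ μ t : ℝ, (μ, t) ∈ RealQuadratic.U₁ ∪ RealQuadratic.U₂ ∪ RealQuadratic.U₃ ∧
        RealQuadratic.RealConj f (RealQuadratic.normalForm μ t)) ∨
      RealQuadratic.realEntropy f = 0 ∨
      RealQuadratic.realEntropy f = ((Real.log 2 : ℝ) : EReal)) :=
  ⟨fun _ _ h => RealQuadratic.isUnimodalOn_of_mem_U₁ h,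
    fun _ _ h => RealQuadratic.isUnimodalOn_of_mem_U₂ h,
    fun _ _ h => RealQuadratic.isPlusMinusPlusBimodalOn_of_mem_U₃ h,
    fun _ hf => RealQuadratic.realConj_or_entropy hf⟩
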